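/- Work in \(L^2(\mathbb R)\) with the Fourier transform \(\hat f(\lambda)=\frac1{\sqrt{2\pi}}\int_{\mathbb R} f(x)e^{-i\lambda x}\,dx\); an operator \(\mathcal T\) has Fourier symbol \(\hat{\mathcal T}_\lambda\) if \(\widehat{\mathcal T f}(\lambda)=\hat{\mathcal T}_\lambda\hat f(\lambda)\) for all \(f\) in its domain. Consider the plant \[ \frac{d\psi}{dt}=\mathcal A\psi+\mathcal B w,\qquad y=\mathcal C\psi+\mathcal G v , \] where \(w,v\) are independent Gaussian white noises with identity covariance operators, all fields are real and scalar, and: (i) \(\mathcal A\) is a densely defined, spatially invariant, constant-coefficient differential operator which generates a \(C_0\)-semigroup on \(L^2(\mathbb R)\) and has a continuous Fourier symbol \(\hat{\mathcal A}_\lambda\); (ii) \(\mathcal B,\mathcal C,\mathcal G\) are bounded, linear, spatially invariant operators on \(L^2(\mathbb R)\) whose Fourier symbols are proper rational functions of \(\lambda\) without zeros and without real poles, and \(\mathcal G\mathcal G^*\) and \(\mathcal B\mathcal B^*\) are positive definite (the inverse \((\mathcal G\mathcal G^*)^{-1}\), defined on the range of \(\mathcal G\mathcal G^*\), may be unbounded);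 (iii) \((\mathcal A,\mathcal B)\) and \((\mathcal A^*,\mathcal C^*)\) are exponentially stabilizable; (iv) \(\mathcal C=\mathcal I\) (noisy measurements of the full state). The Kalman filter is \[ \frac{d\tilde\psi}{dt}=(\mathcal A-\mathcal L\mathcal C)\tilde\psi+\mathcal L y,\qquad \tilde\psi(0)=0,\qquad \mathcal L=\mathcal P\mathcal C^*(\mathcal G\mathcal G^*)^{-1}, \] where \(\mathcal L\) is understood as the closure of the operator defined on the range of \(\mathcal G\mathcal G^*\), and \(\mathcal P\), the steady-state covariance operator of the optimal estimation error, is the stabilizing solution of the algebraic Riccati equation, i.e. the bounded self-adjoint operator such that \[ \big\langle(\mathcal A\mathcal P+\mathcal P\mathcal A^*+\mathcal B\mathcal B^*-\mathcal P\mathcal C^*(\mathcal G\mathcal G^*)^{-1}\mathcal C\mathcal P)h,f\big\rangle=0\qquad\text{for all }h,f\in\mathcal D(\mathcal A^*) \] (with \(\langle\mathcal A\mathcal Ph,f\rangle\) read as \(\langle\mathcal Ph,\mathcal A^*f\rangle\), and with \(\mathcal C\mathcal Ph\) in the range of \(\mathcal G\mathcal G^*\)) and such that \(\mathcal A-\mathcal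 L\mathcal C\) generates an exponentially stable \(C_0\)-semigroup. Suppose that there is a constant \(\ell>0\) satisfying the matching condition \[ |\hat{\mathcal B}_\lambda|^2=\ell\big(\ell-2\,\mathrm{Re}\,\hat{\mathcal A}_\lambda\big)|\hat{\mathcal G}_\lambda|^2\qquad\text{for all }\lambda\in\mathbb R . \] Then the Kalman filter is well defined (the stabilizing solution \(\mathcal P\) exists, is unique, and is nonnegative), its gain is \(\mathcal L=\ell\,\mathcal I\), with Fourier symbol identically equal to \(\ell\), and the Kalman filter is \[ \frac{d\tilde\psi}{dt}=(\mathcal A-\ell\,\mathcal I)\tilde\psi+\ell\,y,\qquad\tilde\psi(0)=0, \] that is, it is completely decentralized. Moreover \(\mathcal P\) is the steady-state error covariance of this filter and is minimal: for every bounded gain \(\mathcal K\) such that \(\mathcal A-\mathcal K\mathcal C\) generates an exponentially stable semigroup \(T_{\mathcal K}(t)\), and for every \(h\in L^2(\mathbb R)\), \[ \langle\mathcal Ph,h\rangle\le\int_0^\infty\big(\|\mathcal B^*T_{\mathcal K}(t)^*h\|^2+\|\mathcal G^*\mathcal K^*T_{\mathcal K}(t)^*h\|^2\big)\,dt , \]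 the steady-state variance of \(\langle\psi-\tilde\psi,h\rangle\) for the filter with gain \(\mathcal K\), with equality for \(\mathcal K=\ell\,\mathcal I\). -/

import Mathlib

open MeasureTheory Set Filter Topology
open scoped ENNReal FourierTransform SchwartzMap

namespace SIS

/-- The Hilbert space `L²(ℝ)` of (complex valued) square integrable functions. -/
abbrev L2 : Type := Lp ℂ 2 (volume : Measure ℝ)

noncomputable section

/-- A bounded operator regarded as an everywhere defined, possibly unbounded operator. -/
def ofCLM (T : L2 →L[ℂ] L2) : L2 →ₗ.[ℂ] L2 :=
  (T : L2 →ₗ[ℂ] L2).toPMap ⊤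

/-- The composition `L C` of an unbounded operator `L` with a bounded operator `C`, on its natural
domain `{f : C f ∈ D(L)}`. -/
def compCLM (L : L2 →ₗ.[ℂ] L2) (C : L2 →L[ℂ] L2) : L2 →ₗ.[ℂ] L2 where
  domain := L.domain.comap (C : L2 →ₗ[ℂ] L2)
  toFun := L.toFun ∘ₗ (C : L2 →ₗ[ℂ] L2).submoduleComap L.domain

/-! ### Spatial invariance, Fourier symbols, classes of operators -/

/-- The translation `[T_z f](x) = f(x - z)`. -/
def translation (z : ℝ) (f : L2) : L2 :=
  Lp.compMeasurePreserving (fun x : ℝ => x - z) (measurePreserving_sub_right volume z) f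

/-- Translations map the domain into itself and commute with the operator. -/
def IsSpatiallyInvariant (T : L2 →ₗ.[ℂ] L2) : Prop :=
  ∀ (z : ℝ) (f : T.domain), ∃ h : translation z f ∈ T.domain,
    T ⟨translation z f, h⟩ = translation z (T f)

/-- `m` is the Fourier symbol of `T`: `(T f)^(λ) = m(λ) f^(λ)` for every `f ∈ D(T)`, where
`f^(λ) = (2π)^(-1/2) ∫ f(x) exp(-iλx) dx`.  Mathlib's transform `𝓕 f (ξ) = ∫ f(x) exp(-2πixξ) dx`
satisfies `f^(2πξ) = (2π)^(-1/2) 𝓕 f (ξ)`, whence the argument `2πξ` below. -/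
def HasFourierSymbol (T : L2 →ₗ.[ℂ] L2) (m : ℝ → ℂ) : Prop :=
  ∀ f : T.domain,
    (𝓕 (T f) : L2) =ᵐ[volume] fun ξ : ℝ => m (2 * Real.pi * ξ) * (𝓕 (f : L2) : L2) ξ

/-- The operator maps real fields to real fields: it commutes with complex conjugation. -/
def IsReal (T : L2 →ₗ.[ℂ] L2) : Prop :=
  ∀ f : T.domain, ∃ h : star (f : L2) ∈ T.domain, T ⟨star (f : L2), h⟩ = star (T f)

/-- `T` is a (constant coefficient) differential operator `∑ₖ pₖ ∂ᵏ`, the derivatives being taken in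
the sense of distributions. -/
def IsDifferentialOperator (T : L2 →ₗ.[ℂ] L2) : Prop :=
  ∃ p : Polynomial ℂ, ∀ (f : T.domain) (φ : 𝓢(ℝ, ℂ)),
    ∫ x, (T f : L2) x * φ x =
      ∑ k ∈ Finset.range (p.natDegree + 1),
        p.coeff k * (-1) ^ k * ∫ x, (f : L2) x * iteratedDeriv k φ x

/-- `m` is a proper rational function without zeros and without real poles. -/
def IsProperRational (m : ℝ → ℂ) : Prop :=
  ∃ q r : Polynomial ℂ, q.degree ≤ r.degree ∧ (∀ z : ℂ, q.eval z ≠ 0) ∧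
    (∀ x : ℝ, r.eval (x : ℂ) ≠ 0) ∧ ∀ x : ℝ, m x = q.eval (x : ℂ) / r.eval (x : ℂ)

/-- A positive definite bounded operator. -/
def IsPositiveDefinite (T : L2 →L[ℂ] L2) : Prop :=
  T.IsPositive ∧ ∀ f : L2, f ≠ 0 → 0 < (inner ℂ (T f) f : ℂ).re

/-! ### Strongly continuous semigroups -/

/-- `T(t)`, `t ≥ 0`, is a strongly continuous semigroup (values at `t < 0` are irrelevant). -/
structure IsC0Semigroup (T : ℝ → L2 →L[ℂ] L2) : Prop where
  zero : T 0 = 1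
  add : ∀ s t : ℝ, 0 ≤ s → 0 ≤ t → T (s + t) = T s ∘L T t
  cont : ∀ f : L2, ContinuousOn (fun t => T t f) (Ici 0)

/-- `A` is the infinitesimal generator of `T`: `f ∈ D(A)` and `A f = g` exactly when
`(T(t) f - f) / t → g` as `t → 0+`. -/
def IsGenerator (A : L2 →ₗ.[ℂ] L2) (T : ℝ → L2 →L[ℂ] L2) : Prop :=
  ∀ f g : L2, (f, g) ∈ A.graph ↔
    Tendsto (fun t : ℝ => ((t⁻¹ : ℝ) : ℂ) • (T t f - f)) (𝓝[>] 0) (𝓝 g)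

/-- `‖T(t)‖ ≤ M exp(-ωt)` for some `ω > 0`. -/
def IsExponentiallyStable (T : ℝ → L2 →L[ℂ] L2) : Prop :=
  ∃ M ω : ℝ, 0 < ω ∧ ∀ t : ℝ, 0 ≤ t → ‖T t‖ ≤ M * Real.exp (-ω * t)

/-- `A` generates a strongly continuous semigroup. -/
def GeneratesC0 (A : L2 →ₗ.[ℂ] L2) : Prop :=
  ∃ T, IsC0Semigroup T ∧ IsGenerator A T

/-- `A` generates an exponentially stable strongly continuous semigroup. -/
def GeneratesStable (A : L2 →ₗ.[ℂ] L2) : Prop :=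
  ∃ T, IsC0Semigroup T ∧ IsGenerator A T ∧ IsExponentiallyStable T

/-- The pair `(A, B)` is exponentially stabilizable: `A + B F` generates an exponentially stable
semigroup for some bounded `F`. -/
def IsStabilizable (A : L2 →ₗ.[ℂ] L2) (B : L2 →L[ℂ] L2) : Prop :=
  ∃ F : L2 →L[ℂ] L2, GeneratesStable (A + ofCLM (B ∘L F))

/-! ### The plant -/

/-- The plant `dψ/dt = A ψ + B w`, `y = C ψ + G v`; `w` and `v` are independent Gaussian white
noises with identity covariance operators, so `B w` and `G v` have covariances `B B*` and
`G G*`. -/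
structure Plant where
  A : L2 →ₗ.[ℂ] L2
  B : L2 →L[ℂ] L2
  C : L2 →L[ℂ] L2
  G : L2 →L[ℂ] L2

/-- The standing assumptions on the plant, with Fourier symbols `a, b, c, g` of `A, B, C, G`. -/
structure Plant.Assumptions (S : Plant) (a b c g : ℝ → ℂ) : Prop where
  /-- All fields are real. -/
  real_A : IsReal S.A
  real_B : IsReal (ofCLM S.B)
  real_C : IsReal (ofCLM S.C)
  real_G : IsReal (ofCLM S.G)
  /-- `A` is a densely defined differential operator, it generates a strongly continuous semigroup,
  and its Fourier symbol is continuous. -/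
  dense_A : Dense (S.A.domain : Set L2)
  diff_A : IsDifferentialOperator S.A
  gen_A : GeneratesC0 S.A
  invariant_A : IsSpatiallyInvariant S.A
  symbol_A : HasFourierSymbol S.A a
  continuous_a : Continuous a
  /-- `B`, `C`, `G` are spatially invariant. -/
  invariant_B : IsSpatiallyInvariant (ofCLM S.B)
  invariant_C : IsSpatiallyInvariant (ofCLM S.C)
  invariant_G : IsSpatiallyInvariant (ofCLM S.G)
  /-- Their symbols are proper rational functions without zeros and without real poles. -/
  symbol_B : HasFourierSymbol (ofCLM S.B) b
  symbol_C : HasFourierSymbol (ofCLM S.C) c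
  symbol_G : HasFourierSymbol (ofCLM S.G) g
  rational_b : IsProperRational b
  rational_c : IsProperRational c
  rational_g : IsProperRational g
  /-- `G G*` and `B B*` are positive definite.  (Then `G G*` is injective with dense range; its
  inverse may be unbounded.) -/
  posDef_G : IsPositiveDefinite (S.G ∘L S.G.adjoint)
  posDef_B : IsPositiveDefinite (S.B ∘L S.B.adjoint)
  /-- `(A, B)` and `(A*, C*)` are exponentially stabilizable. -/
  stabilizable : IsStabilizable S.A S.B
  detectable : IsStabilizable S.A.adjoint S.C.adjoint
  /-- Full state noisy measurements: `y = ψ + G v`. -/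
  full_state : S.C = 1

/-! ### The Kalman filter -/

/-- `(G G*)⁻¹`, with domain the range of `G G*`. -/
def Plant.noiseInv (S : Plant) : L2 →ₗ.[ℂ] L2 :=
  (ofCLM (S.G ∘L S.G.adjoint)).inverse

/-- The gain `P C* (G G*)⁻¹`.  The product is defined on the range of `G G*`, a proper dense
subspace in general, and it is extended by taking the closure. -/
def Plant.kalmanGain (S : Plant) (P : L2 →L[ℂ] L2) : L2 →ₗ.[ℂ] L2 :=
  (((P ∘L S.C.adjoint : L2 →L[ℂ] L2) : L2 →ₗ[ℂ] L2).compPMap S.noiseInv).closure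

/-- A linear filter `dψ~/dt = F ψ~ + L y`, `ψ~(0) = 0`, given by its operators. -/
structure LinearFilter where
  drift : L2 →ₗ.[ℂ] L2
  gain : L2 →ₗ.[ℂ] L2

/-- `ψ` is a (classical) solution of the filter equation driven by the measurement `y`. -/
def LinearFilter.Solves (F : LinearFilter) (y ψ : ℝ → L2) : Prop :=
  ψ 0 = 0 ∧ ∀ t : ℝ, 0 ≤ t → ∃ (h : ψ t ∈ F.drift.domain) (h' : y t ∈ F.gain.domain),
    HasDerivWithinAt ψ (F.drift ⟨ψ t, h⟩ + F.gain ⟨y t, h'⟩) (Ici 0) t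

/-- The filter `dψ~/dt = (A - L C) ψ~ + L y` with `L = P C* (G G*)⁻¹`. -/
def Plant.kalmanFilter (S : Plant) (P : L2 →L[ℂ] L2) : LinearFilter where
  drift := S.A - compCLM (S.kalmanGain P) S.C
  gain := S.kalmanGain P

/-- The algebraic Riccati equation
`⟨(A P + P A* + B B* - P C* (G G*)⁻¹ C P) h, f⟩ = 0` for all `h, f ∈ D(A*)`
(`⟨A P h, f⟩` is read as `⟨P h, A* f⟩`; Mathlib's inner product is linear in the second slot). -/
def Plant.SolvesRiccati (S : Plant) (P : L2 →L[ℂ] L2) : Prop :=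
  ∀ h : S.A.adjoint.domain, ∃ hP : S.C (P h) ∈ S.noiseInv.domain, ∀ f : S.A.adjoint.domain,
    inner ℂ (S.A.adjoint f) (P h) + inner ℂ (f : L2) (P (S.A.adjoint h))
      + inner ℂ (f : L2) (S.B (S.B.adjoint h))
      - inner ℂ (f : L2) (P (S.C.adjoint (S.noiseInv ⟨S.C (P h), hP⟩))) = 0

/-- `P` is a stabilizing solution of the Riccati equation: a bounded self-adjoint solution for which
`A - P C* (G G*)⁻¹ C` generates an exponentially stable semigroup.  The steady state covariance
operator defining the Kalman filter is the unique such `P`. -/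
structure Plant.IsStabilizingSolution (S : Plant) (P : L2 →L[ℂ] L2) : Prop where
  selfAdjoint : IsSelfAdjoint P
  riccati : S.SolvesRiccati P
  stabilizing : GeneratesStable (S.kalmanFilter P).drift

/-- The semigroup `T` is the exponentially stable semigroup generated by `A - K C`, which governs
the error `e = ψ - ψ~` of the filter `dψ~/dt = (A - K C) ψ~ + K y`. -/
def Plant.IsErrorSemigroup (S : Plant) (K : L2 →L[ℂ] L2) (T : ℝ → L2 →L[ℂ] L2) : Prop :=
  IsC0Semigroup T ∧ IsGenerator (S.A - ofCLM (K ∘L S.C)) T ∧ IsExponentiallyStable T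

/-- The steady state variance of `⟨e, h⟩`, where `e = ψ - ψ~` obeys
`de/dt = (A - K C) e + B w - K G v`: for independent white noises `w, v` with identity covariance it
equals `∫₀^∞ (‖B* T(t)* h‖² + ‖G* K* T(t)* h‖²) dt`, `T` being the semigroup of `A - K C`. -/
def Plant.errorVariance (S : Plant) (K : L2 →L[ℂ] L2) (T : ℝ → L2 →L[ℂ] L2) (h : L2) : ℝ≥0∞ :=
  ∫⁻ t in Ioi (0 : ℝ), ENNReal.ofReal
    (‖S.B.adjoint ((T t).adjoint h)‖ ^ 2 + ‖S.G.adjoint (K.adjoint ((T t).adjoint h))‖ ^ 2)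

/-- The filter `dψ~/dt = (A - ℓ I) ψ~ + ℓ y`. -/
def decentralizedFilter (A : L2 →ₗ.[ℂ] L2) (l : ℝ) : LinearFilter where
  drift := A - ofCLM ((l : ℂ) • (1 : L2 →L[ℂ] L2))
  gain := ofCLM ((l : ℂ) • (1 : L2 →L[ℂ] L2))

/-- The filter is completely decentralized: it has the form `dψ~/dt = (A - ℓ I) ψ~ + ℓ y` for some
positive constant `ℓ`. -/
def LinearFilter.IsCompletelyDecentralized (F : LinearFilter) (A : L2 →ₗ.[ℂ] L2) : Prop :=
  ∃ l : ℝ, 0 < l ∧ F = decentralizedFilter A l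

end

end SIS

/-! ### Right derivatives of semigroup orbits and growth bounds -/

namespace SIS

/-! The solution is `P = ℓ N` with `N = G G*`. On the Fourier side the Riccati equation for the
symbol `ℓ|g|²` reads `2ℓ Re(a)|g|² + |b|² - ℓ²|g|² = 0`, which is the matching condition
(`riccati_identity`). On the range of `N` the gain `P N⁻¹` is multiplication by `ℓ`; that range is
dense, so the closure is `ℓ I` (`kalmanGain_smul_noise`). Since `b` has no zeros, matching forces
`Re a < ℓ/2`, so `A - ℓ` generates a semigroup decaying like `exp(-ℓt/2)` (`exists_errorSemigroup`).

Uniqueness: if `Q` is another stabilizing solution and `X = Q - ℓN`, subtracting the Riccati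
equations gives `D X + X (A - ℓ)* = 0`, where `D` is the closed-loop generator of `Q`. Hence `U(t) X
T(t)*` is constant in `t` for the two stable semigroups and tends to zero, so `X = 0`
(`eq_zero_of_intertwines`). The delicate point is that `X` maps `D(A*)` into the domain of `D`,
where the gain of `Q` may be unbounded.

Minimality: for a bounded stabilizing gain `K`, completing the square in the Riccati equation shows
that `⟨Pu, u⟩` changes along the adjoint error semigroup at the rate `-(‖B*u‖² + ‖G*K*u‖²) + ‖G*(K*
- ℓ)u‖²` (`re_energy_eq`). Integrating over `[0, ∞)` bounds `⟨Ph, h⟩` by the error variance, with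
equality when `K = ℓ I`. -/

theorem hasDerivWithinAt_Ici_iff_tendsto {f : ℝ → L2} {g : L2} {t : ℝ} :
    HasDerivWithinAt f g (Ici t) t ↔
      Tendsto (fun s : ℝ => ((s⁻¹ : ℝ) : ℂ) • (f (t + s) - f t)) (𝓝[>] 0) (𝓝 g) := by
  have hmap : 𝓝[>] t = map (fun s => t + s) (𝓝[>] (0 : ℝ)) := by simp
  rw [← hasDerivWithinAt_Ioi_iff_Ici, hasDerivWithinAt_iff_tendsto_slope' self_notMem_Ioi, hmap,
    tendsto_map'_iff]
  refine tendsto_congr fun s => ?_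
  simp only [Function.comp_apply, slope_def_module, add_sub_cancel_left]
  rw [Complex.coe_smul]
  rfl

theorem IsGenerator.tendsto {A : L2 →ₗ.[ℂ] L2} {T : ℝ → L2 →L[ℂ] L2} (hG : IsGenerator A T)
    (f : A.domain) :
    Tendsto (fun t : ℝ => ((t⁻¹ : ℝ) : ℂ) • (T t f - f)) (𝓝[>] 0) (𝓝 (A f)) :=
  (hG f (A f)).1 (A.mem_graph f)

namespace IsC0Semigroup

variable {A : L2 →ₗ.[ℂ] L2} {T : ℝ → L2 →L[ℂ] L2}

theorem hasDerivWithinAt (hT : IsC0Semigroup T) {f g : L2}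
    (h : Tendsto (fun t : ℝ => ((t⁻¹ : ℝ) : ℂ) • (T t f - f)) (𝓝[>] 0) (𝓝 g)) {t : ℝ}
    (ht : 0 ≤ t) : HasDerivWithinAt (fun s => T s f) (T t g) (Ici t) t := by
  rw [hasDerivWithinAt_Ici_iff_tendsto]
  refine ((T t).continuous.tendsto g |>.comp h).congr' ?_
  filter_upwards [self_mem_nhdsWithin] with s hs
  simp [hT.add t s ht (le_of_lt hs)]

theorem map_mem_graph (hT : IsC0Semigroup T) (hG : IsGenerator A T) (f : A.domain) {t : ℝ}
    (ht : 0 ≤ t) : (T t f, T t (A f)) ∈ A.graph := by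
  rw [hG]
  refine ((T t).continuous.tendsto (A f) |>.comp (hG.tendsto f)).congr' ?_
  filter_upwards [self_mem_nhdsWithin] with s hs
  have h : T t (T s f) = T s (T t f) := by
    rw [← ContinuousLinearMap.comp_apply, ← hT.add t s ht (le_of_lt hs), add_comm,
      hT.add s t (le_of_lt hs) ht, ContinuousLinearMap.comp_apply]
  simp [h]

end IsC0Semigroup

/-- A bounded, strongly continuous family of operators is jointly continuous. -/
theorem continuous_uncurry_of_bounded {T : ℝ → L2 →L[ℂ] L2} {M : ℝ}
    (hM : ∀ t, 0 ≤ t → ‖T t‖ ≤ M) (hc : ∀ f, ContinuousOn (fun t => T t f) (Ici 0)) :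
    Continuous fun p : L2 × ℝ => T (max p.2 0) p.1 := by
  rw [continuous_iff_continuousAt]
  rintro ⟨h, t⟩
  have hc' : Continuous fun s : ℝ => T (max s 0) h :=
    (hc h).comp_continuous (continuous_id.max continuous_const) fun s =>
      mem_Ici.2 (le_max_right _ _)
  rw [ContinuousAt, tendsto_iff_norm_sub_tendsto_zero]
  have h1 : Tendsto (fun p : L2 × ℝ => M * ‖p.1 - h‖ + ‖T (max p.2 0) h - T (max t 0) h‖)
      (𝓝 (h, t)) (𝓝 0) := by
    have : Continuous fun p : L2 × ℝ =>
        M * ‖p.1 - h‖ + ‖T (max p.2 0) h - T (max t 0) h‖ := by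
      have := hc'.comp (continuous_snd (X := L2) (Y := ℝ))
      exact (continuous_const.mul (continuous_fst.sub continuous_const).norm).add
        (this.sub continuous_const).norm
    simpa using this.tendsto (h, t)
  refine squeeze_zero (fun _ => norm_nonneg _) (fun p => ?_) h1
  calc ‖T (max p.2 0) p.1 - T (max t 0) h‖
      = ‖T (max p.2 0) (p.1 - h) + (T (max p.2 0) h - T (max t 0) h)‖ := by
        rw [map_sub]; congr 1; abel
    _ ≤ ‖T (max p.2 0) (p.1 - h)‖ + ‖T (max p.2 0) h - T (max t 0) h‖ := norm_add_le _ _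
    _ ≤ _ := by
      gcongr
      exact (T _).le_of_opNorm_le (hM _ (le_max_right _ _)) _

/-- The product rule for a strongly continuous family of operators applied to a moving vector. -/
theorem hasDerivWithinAt_apply {T : ℝ → L2 →L[ℂ] L2} {M : ℝ}
    (hM : ∀ t, 0 ≤ t → ‖T t‖ ≤ M) (hc : ∀ f, ContinuousOn (fun t => T t f) (Ici 0))
    {v : ℝ → L2} {v' w : L2} {t : ℝ} (ht : 0 ≤ t) (hv : HasDerivWithinAt v v' (Ici t) t)
    (hw : HasDerivWithinAt (fun s => T s (v t)) w (Ici t) t) :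
    HasDerivWithinAt (fun s => T s (v s)) (w + T t v') (Ici t) t := by
  rw [hasDerivWithinAt_Ici_iff_tendsto] at *
  have hj := continuous_uncurry_of_bounded hM hc
  have hlim : Tendsto (fun s : ℝ => ((((s⁻¹ : ℝ) : ℂ) • (v (t + s) - v t)), t + s)) (𝓝[>] 0)
      (𝓝 (v', t)) := by
    refine hv.prodMk_nhds ?_
    have : Continuous fun s : ℝ => t + s := by fun_prop
    simpa using (this.tendsto 0).mono_left nhdsWithin_le_nhds
  have h2 := (hj.tendsto (v', t)).comp hlim
  rw [max_eq_left ht] at h2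
  refine (hw.add h2).congr' ?_
  filter_upwards [self_mem_nhdsWithin] with s hs
  have hs' : 0 ≤ t + s := add_nonneg ht (le_of_lt hs)
  simp only [Function.comp_apply, max_eq_left hs', map_smul, map_sub]
  rw [← smul_add]
  congr 1
  abel

/-- The growth bound of a semigroup whose generator is quasi-dissipative. -/
theorem IsC0Semigroup.norm_le_exp {A : L2 →ₗ.[ℂ] L2} {T : ℝ → L2 →L[ℂ] L2}
    (hT : IsC0Semigroup T) (hG : IsGenerator A T) (hd : Dense (A.domain : Set L2)) {ω : ℝ}
    (hA : ∀ u : A.domain, (inner ℂ (u : L2) (A u) : ℂ).re ≤ ω * ‖(u : L2)‖ ^ 2) {t : ℝ}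
    (ht : 0 ≤ t) : ‖T t‖ ≤ Real.exp (ω * t) := by
  -- For `f` in the domain, quasi-dissipativity makes `exp(-2ωs) ‖T(s) f‖²` nonincreasing.
  have key : ∀ f ∈ (A.domain : Set L2), ‖T t f‖ ≤ Real.exp (ω * t) * ‖f‖ := by
    intro f hf
    have hderiv : ∀ s ∈ Ico 0 t, HasDerivWithinAt
        (fun s => Real.exp (-(2 * ω * s)) * (inner ℂ (T s f) (T s f) : ℂ).re)
        (Real.exp (-(2 * ω * s)) * -(2 * ω) * (inner ℂ (T s f) (T s f) : ℂ).re +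
          Real.exp (-(2 * ω * s)) *
            (inner ℂ (T s f) (T s (A ⟨f, hf⟩)) + inner ℂ (T s (A ⟨f, hf⟩)) (T s f) : ℂ).re)
        (Ici s) s := by
      intro s hs
      have h1 := hT.hasDerivWithinAt (hG.tendsto ⟨f, hf⟩) hs.1
      have h2 := (h1.inner ℂ h1)
      have h3 := (Complex.reCLM.hasFDerivAt.comp_hasDerivWithinAt s h2)
      have h4 : HasDerivWithinAt (fun s => Real.exp (-(2 * ω * s)))
          (Real.exp (-(2 * ω * s)) * -(2 * ω)) (Ici s) s := by
        have : HasDerivAt (fun s : ℝ => -(2 * ω * s)) (-(2 * ω)) s := by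
          simpa using (hasDerivAt_id s).const_mul (-(2 * ω))
        exact this.exp.hasDerivWithinAt
      exact h4.mul h3
    have hcont : ContinuousOn
        (fun s => Real.exp (-(2 * ω * s)) * (inner ℂ (T s f) (T s f) : ℂ).re) (Icc 0 t) := by
      have h1 : ContinuousOn (fun s => T s f) (Icc 0 t) := (hT.cont f).mono Icc_subset_Ici_self
      have h2 : ContinuousOn (fun s => (inner ℂ (T s f) (T s f) : ℂ).re) (Icc 0 t) :=
        Complex.continuous_re.comp_continuousOn (h1.inner h1)
      exact ContinuousOn.mul (by fun_prop) h2
    have hle := image_le_of_deriv_right_le_deriv_boundary hcont hderiv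
      (B := fun _ => ‖f‖ ^ 2) (B' := fun _ => 0) (by
        simp [hT.zero, inner_self_eq_norm_sq_to_K, ← Complex.ofReal_pow]) continuousOn_const
      (fun s _ => hasDerivWithinAt_const _ _ _) (fun s hs => by
        obtain ⟨x, hx1, hx2⟩ := (LinearPMap.mem_graph_iff _).1
          (hT.map_mem_graph hG ⟨f, hf⟩ hs.1)
        simp only at hx1 hx2
        have h := hA x
        rw [hx1, hx2] at h
        have h' : (inner ℂ (T s (A ⟨f, hf⟩)) (T s f) : ℂ).re
            = (inner ℂ (T s f) (T s (A ⟨f, hf⟩)) : ℂ).re := by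
          rw [← inner_conj_symm, Complex.conj_re]
        have h'' : (inner ℂ (T s f) (T s f) : ℂ).re = ‖T s f‖ ^ 2 := by
          simp [inner_self_eq_norm_sq_to_K, ← Complex.ofReal_pow]
        rw [Complex.add_re, h', h'']
        have := Real.exp_pos (-(2 * ω * s))
        nlinarith) (right_mem_Icc.2 ht)
    have h'' : (inner ℂ (T t f) (T t f) : ℂ).re = ‖T t f‖ ^ 2 := by
      simp [inner_self_eq_norm_sq_to_K, ← Complex.ofReal_pow]
    simp only [h''] at hle
    have h5 : ‖T t f‖ ^ 2 ≤ (Real.exp (ω * t) * ‖f‖) ^ 2 := by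
      have h6 : Real.exp (ω * t) ^ 2 * Real.exp (-(2 * ω * t)) = 1 := by
        rw [← Real.exp_nat_mul, ← Real.exp_add, ← Real.exp_zero]; congr 1; push_cast; ring
      calc ‖T t f‖ ^ 2 = Real.exp (ω * t) ^ 2 * (Real.exp (-(2 * ω * t)) * ‖T t f‖ ^ 2) := by
            rw [← mul_assoc, h6, one_mul]
        _ ≤ Real.exp (ω * t) ^ 2 * ‖f‖ ^ 2 := by gcongr
        _ = _ := by ring
    exact le_of_sq_le_sq h5 (by positivity)
  refine ContinuousLinearMap.opNorm_le_bound _ (Real.exp_pos _).le fun f => ?_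
  have hcl : IsClosed {f : L2 | ‖T t f‖ ≤ Real.exp (ω * t) * ‖f‖} :=
    isClosed_le (by fun_prop) (by fun_prop)
  exact hcl.closure_subset_iff.2 key (hd f)

/-! ### Exponential shifts, exponential stability and inverses of generators -/

theorem IsC0Semigroup.exp_smul {T : ℝ → L2 →L[ℂ] L2} (hT : IsC0Semigroup T) (l : ℝ) :
    IsC0Semigroup fun t => (Real.exp (-l * t) : ℂ) • T t where
  zero := by simp [hT.zero]
  add s t hs ht := by
    rw [hT.add s t hs ht, mul_add, Real.exp_add]
    ext1 f
    simp [smul_smul, mul_comm]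
  cont f := by
    have h := hT.cont f
    have h' : Continuous fun t : ℝ => (Real.exp (-l * t) : ℂ) := by fun_prop
    exact h'.continuousOn.smul h

theorem mem_graph_sub_ofCLM {A : L2 →ₗ.[ℂ] L2} {K : L2 →L[ℂ] L2} {f g : L2} :
    (f, g) ∈ (A - ofCLM K).graph ↔ (f, g + K f) ∈ A.graph := by
  simp only [LinearPMap.mem_graph_iff]
  constructor
  · rintro ⟨⟨x, hx⟩, rfl, rfl⟩
    refine ⟨⟨x, hx.1⟩, rfl, ?_⟩
    rw [LinearPMap.sub_apply]
    simp [ofCLM]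
  · rintro ⟨⟨x, hx⟩, rfl, h⟩
    refine ⟨⟨x, hx, trivial⟩, rfl, ?_⟩
    rw [LinearPMap.sub_apply]
    simp only at h ⊢
    rw [h]
    simp [ofCLM]

theorem IsGenerator.exp_smul {A : L2 →ₗ.[ℂ] L2} {T : ℝ → L2 →L[ℂ] L2} (hG : IsGenerator A T)
    (l : ℝ) :
    IsGenerator (A - ofCLM ((l : ℂ) • 1)) fun t => (Real.exp (-l * t) : ℂ) • T t := by
  intro f g
  rw [mem_graph_sub_ofCLM, hG]
  have hexp : Tendsto (fun t : ℝ => (Real.exp (-l * t) : ℂ)) (𝓝[>] 0) (𝓝 1) := by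
    have : Continuous fun t : ℝ => (Real.exp (-l * t) : ℂ) := by fun_prop
    simpa using (this.tendsto 0).mono_left nhdsWithin_le_nhds
  have hexp' : Tendsto (fun t : ℝ => (Real.exp (-l * t) : ℂ)⁻¹) (𝓝[>] 0) (𝓝 1) := by
    simpa using hexp.inv₀ one_ne_zero
  have hder : Tendsto (fun t : ℝ => ((t⁻¹ * (Real.exp (-l * t) - 1) : ℝ) : ℂ) • f) (𝓝[>] 0)
      (𝓝 (((-l : ℝ) : ℂ) • f)) := by
    have h1 : HasDerivAt (fun t : ℝ => Real.exp (-l * t)) (-l) 0 := by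
      have := ((hasDerivAt_id (0 : ℝ)).const_mul (-l)).exp
      simpa using this
    have h2 := h1.tendsto_slope_zero_right
    simp only [zero_add, mul_zero, Real.exp_zero, smul_eq_mul] at h2
    exact ((Complex.continuous_ofReal.tendsto _).comp h2).smul_const f
  simp only [_root_.smul_apply, one_apply_eq_self]
  constructor
  · intro h
    have h1 := (hexp.smul h).add hder
    rw [one_smul] at h1
    convert! h1 using 2
    · simp only [smul_sub, smul_smul, Complex.ofReal_mul, Complex.ofReal_sub, mul_sub, sub_smul]
      simp only [mul_comm]
      simp
    · simp
  · intro h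
    have h1 := hexp'.smul (h.sub hder)
    rw [one_smul] at h1
    convert! h1 using 2 with t
    · have hne : (Real.exp (-l * t) : ℂ) ≠ 0 := by exact_mod_cast (Real.exp_pos _).ne'
      simp only [smul_sub, smul_smul, Complex.ofReal_mul, Complex.ofReal_sub, mul_sub, sub_smul]
      rw [mul_left_comm, inv_mul_cancel₀ hne]
      simp [mul_comm]
    · simp

theorem norm_le_of_dense_inner {s : Set L2} (hs : Dense s) {x : L2} {C : ℝ} (hC : 0 ≤ C)
    (h : ∀ f ∈ s, ‖(inner ℂ x f : ℂ)‖ ≤ C * ‖f‖) : ‖x‖ ≤ C := by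
  have hcl : IsClosed {f : L2 | ‖(inner ℂ x f : ℂ)‖ ≤ C * ‖f‖} :=
    isClosed_le (by fun_prop) (by fun_prop)
  have hx : ‖(inner ℂ x x : ℂ)‖ ≤ C * ‖x‖ := hcl.closure_subset_iff.2 h (hs x)
  rw [inner_self_eq_norm_sq_to_K] at hx
  rcases eq_or_lt_of_le (norm_nonneg x) with h0 | h0
  · rw [← h0]; exact hC
  · have hx' : ‖x‖ * ‖x‖ ≤ C * ‖x‖ := by simpa [sq] using hx
    exact le_of_mul_le_mul_right hx' h0

theorem IsExponentiallyStable.exists_bound {T : ℝ → L2 →L[ℂ] L2} (h : IsExponentiallyStable T) :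
    ∃ M : ℝ, 0 ≤ M ∧ ∀ t, 0 ≤ t → ‖T t‖ ≤ M := by
  obtain ⟨M, ω, hω, hM⟩ := h
  have hM0 : 0 ≤ M := by simpa using (norm_nonneg _).trans (hM 0 le_rfl)
  refine ⟨M, hM0, fun t ht => (hM t ht).trans (mul_le_of_le_one_right hM0 ?_)⟩
  exact Real.exp_le_one_iff.2 (by nlinarith)

theorem IsExponentiallyStable.tendsto_norm {T : ℝ → L2 →L[ℂ] L2} (h : IsExponentiallyStable T) :
    Tendsto (fun t => ‖T t‖) atTop (𝓝 0) := by
  obtain ⟨M, ω, hω, hM⟩ := h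
  have h1 : Tendsto (fun t : ℝ => M * Real.exp (-ω * t)) atTop (𝓝 (M * 0)) := by
    refine Tendsto.const_mul M (Real.tendsto_exp_atBot.comp ?_)
    exact tendsto_id.const_mul_atTop_of_neg (neg_lt_zero.2 hω)
  rw [mul_zero] at h1
  refine squeeze_zero' (Eventually.of_forall fun _ => norm_nonneg _) ?_ h1
  filter_upwards [eventually_ge_atTop 0] with t ht using hM t ht

theorem IsC0Semigroup.integrableOn {T : ℝ → L2 →L[ℂ] L2} (hT : IsC0Semigroup T)
    (hs : IsExponentiallyStable T) (f : L2) : IntegrableOn (fun t => T t f) (Ioi 0) := by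
  obtain ⟨M, ω, hω, hM⟩ := hs
  have h1 : IntegrableOn (fun t : ℝ => M * Real.exp (-ω * t) * ‖f‖) (Ioi 0) :=
    ((exp_neg_integrableOn_Ioi 0 hω).const_mul M).mul_const _
  refine Integrable.mono' h1 ?_ ?_
  · exact ((hT.cont f).mono Ioi_subset_Ici_self).aestronglyMeasurable measurableSet_Ioi
  · refine (ae_restrict_iff' measurableSet_Ioi).2 (Eventually.of_forall fun t ht => ?_)
    exact (T t).le_of_opNorm_le (hM t (le_of_lt ht)) f

/-- The generator of an exponentially stable semigroup is boundedly invertible. -/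
theorem IsC0Semigroup.exists_inverse {A : L2 →ₗ.[ℂ] L2} {T : ℝ → L2 →L[ℂ] L2}
    (hT : IsC0Semigroup T) (hG : IsGenerator A T) (hs : IsExponentiallyStable T) :
    ∃ R : L2 →L[ℂ] L2, (∀ f, (R f, f) ∈ A.graph) ∧ ∀ u : A.domain, R (A u) = u := by
  have hint := hT.integrableOn hs
  obtain ⟨M, ω, hω, hM⟩ := id hs
  have h1 : IntegrableOn (fun t : ℝ => M * Real.exp (-ω * t)) (Ioi 0) :=
    (exp_neg_integrableOn_Ioi 0 hω).const_mul M
  -- The inverse of a stable generator is `R f = -∫₀^∞ T(t) f dt`.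
  let R : L2 →L[ℂ] L2 := LinearMap.mkContinuous
    { toFun := fun f => -∫ t in Ioi (0 : ℝ), T t f
      map_add' := fun f g => by
        simp only [map_add]
        rw [integral_add (hint f) (hint g), neg_add]
      map_smul' := fun c f => by
        simp only [map_smul, RingHom.id_apply]
        rw [integral_smul, smul_neg] }
    (∫ t in Ioi (0 : ℝ), M * Real.exp (-ω * t)) (fun f => by
      simp only [LinearMap.coe_mk, AddHom.coe_mk, norm_neg]
      rw [← integral_mul_const]
      refine norm_integral_le_of_norm_le (h1.mul_const _) ?_
      refine (ae_restrict_iff' measurableSet_Ioi).2 (Eventually.of_forall fun t ht => ?_)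
      exact (T t).le_of_opNorm_le (hM t (le_of_lt ht)) f)
  have hR : ∀ f, R f = -∫ t in Ioi (0 : ℝ), T t f := fun f => rfl
  have hgraph : ∀ f, (R f, f) ∈ A.graph := by
    intro f
    rw [hG]
    have hstep : ∀ s : ℝ, 0 < s → T s (R f) - R f = ∫ t in (0 : ℝ)..s, T t f := by
      intro s hs0
      have e1 : T s (R f) = -∫ t in Ioi s, T t f := by
        rw [hR, map_neg, ← (T s).integral_comp_comm (hint f)]
        have := (measurePreserving_add_right volume s).setIntegral_preimage_emb
          (measurableEmbedding_addRight s) (fun t => T t f) (Ioi s)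
        rw [preimage_add_const_Ioi, sub_self] at this
        rw [← this]
        congr 1
        refine setIntegral_congr_fun measurableSet_Ioi fun t ht => ?_
        rw [add_comm, hT.add s t hs0.le (le_of_lt ht)]
        rfl
      have e2 : ∫ t in Ioi (0 : ℝ), T t f = (∫ t in (0 : ℝ)..s, T t f) + ∫ t in Ioi s, T t f := by
        rw [intervalIntegral.integral_of_le hs0.le, ← setIntegral_union
          (Set.Ioc_disjoint_Ioi le_rfl) measurableSet_Ioi
          ((hint f).mono_set Ioc_subset_Ioi_self) ((hint f).mono_set (Ioi_subset_Ioi hs0.le)),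
          Ioc_union_Ioi_eq_Ioi hs0.le]
      rw [e1, hR, e2]
      abel
    have hderiv : HasDerivWithinAt (fun s => ∫ t in (0 : ℝ)..s, T t f) (T 0 f) (Ici 0) 0 := by
      have hcont : ContinuousWithinAt (fun t => T t f) (Ici 0) 0 := hT.cont f 0 self_mem_Ici
      refine intervalIntegral.integral_hasDerivWithinAt_right (by simp)
        (t := Ioi 0) ?_ (hcont.mono Ioi_subset_Ici_self)
      refine ⟨Ioi 0, self_mem_nhdsWithin, ?_⟩
      exact ((hT.cont f).mono Ioi_subset_Ici_self).aestronglyMeasurable measurableSet_Ioi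
    rw [hasDerivWithinAt_Ici_iff_tendsto] at hderiv
    simp only [hT.zero, one_apply_eq_self, zero_add, intervalIntegral.integral_same,
      sub_zero] at hderiv
    refine hderiv.congr' ?_
    filter_upwards [self_mem_nhdsWithin] with s hs0
    rw [hstep s hs0]
  refine ⟨R, hgraph, fun u => ?_⟩
  -- A kernel vector is fixed by every `T(t)`, and `‖T(t)‖ → 0`. Injectivity turns the right inverse
  -- into a two-sided one.
  have hinj : ∀ z : A.domain, A z = 0 → (z : L2) = 0 := by
    intro z hz
    have hconst : ∀ t : ℝ, 0 ≤ t → T t z = z := by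
      intro t ht
      have := constant_of_has_deriv_right_zero (f := fun s => T s z) (a := 0) (b := t)
        ((hT.cont z).mono Icc_subset_Ici_self)
        (fun s hs0 => by simpa [hz] using hT.hasDerivWithinAt (hG.tendsto z) hs0.1) t
        (right_mem_Icc.2 ht)
      simpa [hT.zero] using this
    have hlim : Tendsto (fun t : ℝ => ‖T t‖ * ‖(z : L2)‖) atTop (𝓝 0) := by
      simpa using hs.tendsto_norm.mul_const ‖(z : L2)‖
    have hle : ‖(z : L2)‖ ≤ 0 := by
      refine ge_of_tendsto hlim ?_
      filter_upwards [eventually_ge_atTop 0] with t ht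
      have := (T t).le_opNorm z
      rwa [hconst t ht] at this
    exact norm_le_zero_iff.1 hle
  obtain ⟨x, hx1, hx2⟩ := (LinearPMap.mem_graph_iff _).1 (hgraph (A u))
  simp only at hx1 hx2
  have := hinj (x - u) (by rw [LinearPMap.map_sub, hx2, sub_self])
  rw [← hx1]
  simpa [sub_eq_zero] using this

/-! ### The adjoint as a relation, and its inverse -/

/-- `h` lies in the domain of the adjoint of `A`, which maps it to `k`. -/
def IsAdjointPair (A : L2 →ₗ.[ℂ] L2) (h k : L2) : Prop :=
  ∀ f : A.domain, inner ℂ k (f : L2) = (inner ℂ h (A f) : ℂ)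

theorem isAdjointPair_sub_ofCLM {A : L2 →ₗ.[ℂ] L2} {K : L2 →L[ℂ] L2} {h k : L2}
    (hk : IsAdjointPair A h k) : IsAdjointPair (A - ofCLM K) h (k - K.adjoint h) := by
  intro f
  obtain ⟨x, hx1, hx2⟩ := (LinearPMap.mem_graph_iff _).1
    (mem_graph_sub_ofCLM.1 ((A - ofCLM K).mem_graph f))
  simp only at hx1 hx2
  have h1 := hk x
  rw [hx1, hx2] at h1
  rw [inner_sub_left, h1, ContinuousLinearMap.adjoint_inner_left, inner_add_right]
  ring

theorem isAdjointPair_of_sub_ofCLM {A : L2 →ₗ.[ℂ] L2} {K : L2 →L[ℂ] L2} {h k : L2}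
    (hk : IsAdjointPair (A - ofCLM K) h k) : IsAdjointPair A h (k + K.adjoint h) := by
  intro f
  have hf : ((f : L2), A f - K f) ∈ (A - ofCLM K).graph := by
    rw [mem_graph_sub_ofCLM, sub_add_cancel]
    exact A.mem_graph f
  obtain ⟨x, hx1, hx2⟩ := (LinearPMap.mem_graph_iff _).1 hf
  simp only at hx1 hx2
  have h1 := hk x
  rw [hx1, hx2, inner_sub_right] at h1
  rw [inner_add_left, h1, ContinuousLinearMap.adjoint_inner_left]
  ring

theorem isAdjointPair_adjoint {A : L2 →ₗ.[ℂ] L2} (hd : Dense (A.domain : Set L2))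
    (h : A.adjoint.domain) : IsAdjointPair A h (A.adjoint h) := fun f =>
  LinearPMap.adjoint_isFormalAdjoint hd h f

theorem IsAdjointPair.mem_domain {A : L2 →ₗ.[ℂ] L2} {h k : L2} (hk : IsAdjointPair A h k) :
    h ∈ A.adjoint.domain :=
  LinearPMap.mem_adjoint_domain_of_exists h ⟨k, hk⟩

theorem IsAdjointPair.adjoint_apply {A : L2 →ₗ.[ℂ] L2} (hd : Dense (A.domain : Set L2)) {h k : L2}
    (hk : IsAdjointPair A h k) : A.adjoint ⟨h, hk.mem_domain⟩ = k :=
  LinearPMap.adjoint_apply_eq hd _ hk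

section Inverse

variable {A : L2 →ₗ.[ℂ] L2} {R : L2 →L[ℂ] L2}

theorem isAdjointPair_adjoint_inverse (hR : ∀ u : A.domain, R (A u) = u) (f : L2) :
    IsAdjointPair A (R.adjoint f) f := fun u => by
  rw [ContinuousLinearMap.adjoint_inner_left, hR]

theorem IsAdjointPair.adjoint_inverse_apply (hR : ∀ f, (R f, f) ∈ A.graph) {h k : L2}
    (hk : IsAdjointPair A h k) : R.adjoint k = h := by
  refine ext_inner_right ℂ fun f => ?_
  obtain ⟨x, hx1, hx2⟩ := (LinearPMap.mem_graph_iff _).1 (hR f)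
  simp only at hx1 hx2
  rw [ContinuousLinearMap.adjoint_inner_left, ← hx1, hk x, hx2]

theorem denseRange_adjoint {R : L2 →L[ℂ] L2} (hR : ∀ f, R f = 0 → f = 0) :
    DenseRange R.adjoint := by
  have h1 : Dense (LinearMap.range (R.adjoint : L2 →ₗ[ℂ] L2) : Set L2) := by
    rw [Submodule.dense_iff_topologicalClosure_eq_top,
      Submodule.topologicalClosure_eq_top_iff, Submodule.eq_bot_iff]
    intro f hf
    refine hR f (ext_inner_left ℂ fun g => ?_)
    rw [inner_zero_right, ← ContinuousLinearMap.adjoint_inner_left]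
    exact (Submodule.mem_orthogonal _ _).1 hf _ ⟨g, rfl⟩
  exact h1

/-- The range of `R*` consists of vectors in the domain of the adjoint, and it is dense because `R`
is injective. -/
theorem dense_isAdjointPair (hR : ∀ f, (R f, f) ∈ A.graph) (hR' : ∀ u : A.domain, R (A u) = u) :
    Dense {h | ∃ k, IsAdjointPair A h k} := by
  have h1 : DenseRange R.adjoint := by
    refine denseRange_adjoint fun f h0 => ?_
    obtain ⟨x, hx1, hx2⟩ := (LinearPMap.mem_graph_iff _).1 (hR f)
    simp only at hx1 hx2
    have hx : x = 0 := Subtype.ext (by rw [hx1, h0]; rfl)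
    rw [← hx2, hx, LinearPMap.map_zero]
  refine h1.mono ?_
  rintro _ ⟨f, rfl⟩
  exact ⟨f, isAdjointPair_adjoint_inverse hR' f⟩

/-- A boundedly invertible operator agrees with its second adjoint. -/
theorem mem_graph_of_inner_eq (hR : ∀ f, (R f, f) ∈ A.graph) (hR' : ∀ u : A.domain, R (A u) = u)
    {v w : L2} (h : ∀ f k, IsAdjointPair A f k → inner ℂ k v = (inner ℂ f w : ℂ)) :
    (v, w) ∈ A.graph := by
  have hv : v = R w := by
    refine ext_inner_left ℂ fun f => ?_
    rw [h _ f (isAdjointPair_adjoint_inverse hR' f), ContinuousLinearMap.adjoint_inner_left]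
  rw [hv]
  exact hR w

end Inverse

/-! ### The adjoint semigroup -/

section AdjointSemigroup

variable {A : L2 →ₗ.[ℂ] L2} {T : ℝ → L2 →L[ℂ] L2}

theorem IsAdjointPair.semigroup {h k : L2} (hk : IsAdjointPair A h k) (hT : IsC0Semigroup T)
    (hG : IsGenerator A T) {t : ℝ} (ht : 0 ≤ t) :
    IsAdjointPair A ((T t).adjoint h) ((T t).adjoint k) := by
  intro f
  obtain ⟨x, hx1, hx2⟩ := (LinearPMap.mem_graph_iff _).1 (hT.map_mem_graph hG f ht)
  simp only at hx1 hx2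
  rw [ContinuousLinearMap.adjoint_inner_left, ContinuousLinearMap.adjoint_inner_left, ← hx1,
    hk x, hx2]

/-- Weak form of `T(τ)*h - h = ∫₀^τ T(s)*k ds`: tested against `f ∈ D(A)`, the left side is
differentiable in `τ`, and the mean value inequality applies without strong continuity of the
adjoints. Taking `c = 0` gives a Lipschitz bound for orbits, and `c = k` gives the derivative at
zero. -/
theorem IsAdjointPair.norm_sub_sub_le {h k c : L2} (hk : IsAdjointPair A h k)
    (hT : IsC0Semigroup T) (hG : IsGenerator A T) (hd : Dense (A.domain : Set L2)) {τ C : ℝ}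
    (hτ : 0 ≤ τ) (hC : 0 ≤ C) (hb : ∀ s ∈ Ico 0 τ, ‖(T s).adjoint k - c‖ ≤ C) :
    ‖(T τ).adjoint h - h - (τ : ℂ) • c‖ ≤ C * τ := by
  refine norm_le_of_dense_inner hd (by positivity) fun f hf => ?_
  have hderiv : ∀ s ∈ Ico 0 τ, HasDerivWithinAt
      (fun s : ℝ => (inner ℂ h (T s f) - (s : ℂ) * inner ℂ c f : ℂ))
      (inner ℂ ((T s).adjoint k - c) f : ℂ) (Ici s) s := by
    intro s hs
    have h1 := hT.hasDerivWithinAt (hG.tendsto ⟨f, hf⟩) hs.1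
    have h2 := (hasDerivWithinAt_const s (Ici s) h).inner ℂ h1
    have h3 : HasDerivWithinAt (fun s : ℝ => (s : ℂ) * (inner ℂ c f : ℂ))
        (1 * (inner ℂ c f : ℂ)) (Ici s) s :=
      (Complex.ofRealCLM.hasDerivAt.hasDerivWithinAt).mul_const _
    obtain ⟨x, hx1, hx2⟩ := (LinearPMap.mem_graph_iff _).1 (hT.map_mem_graph hG ⟨f, hf⟩ hs.1)
    simp only at hx1 hx2
    convert! h2.sub h3 using 1
    rw [inner_sub_left, ContinuousLinearMap.adjoint_inner_left, ← hx2, ← hk x, hx1]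
    simp
  have hcont : ContinuousOn (fun s : ℝ => (inner ℂ h (T s f) - (s : ℂ) * inner ℂ c f : ℂ))
      (Icc 0 τ) := by
    refine ContinuousOn.sub ?_ (by fun_prop)
    exact continuousOn_const.inner ((hT.cont f).mono Icc_subset_Ici_self)
  have h4 := norm_image_sub_le_of_norm_deriv_right_le_segment hcont hderiv (C := C * ‖f‖)
    (fun s hs => (norm_inner_le_norm _ _).trans (by gcongr; exact hb s hs)) τ (right_mem_Icc.2 hτ)
  calc _ = _ := by
        rw [inner_sub_left, inner_sub_left, ContinuousLinearMap.adjoint_inner_left, inner_smul_left]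
        simp only [hT.zero, one_apply_eq_self, Complex.conj_ofReal, Complex.ofReal_zero, zero_mul,
          sub_zero]
        rw [sub_right_comm]
    _ ≤ _ := h4
    _ = _ := by ring

/-- The adjoints of a bounded semigroup are strongly continuous. -/
theorem IsC0Semigroup.adjoint (hT : IsC0Semigroup T) (hG : IsGenerator A T)
    (hd : Dense (A.domain : Set L2)) (hd' : Dense {h | ∃ k, IsAdjointPair A h k}) {M : ℝ}
    (hM0 : 0 ≤ M) (hM : ∀ t, 0 ≤ t → ‖T t‖ ≤ M) : IsC0Semigroup fun t => (T t).adjoint := by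
  have hadd : ∀ s t : ℝ, 0 ≤ s → 0 ≤ t →
      (T (s + t)).adjoint = (T s).adjoint ∘L (T t).adjoint := by
    intro s t hs ht
    rw [add_comm, hT.add t s ht hs, ContinuousLinearMap.adjoint_comp]
  have hMa : ∀ t, 0 ≤ t → ‖(T t).adjoint‖ ≤ M := fun t ht => by
    rw [LinearIsometryEquiv.norm_map]; exact hM t ht
  refine ⟨?_, hadd, fun h => ?_⟩
  · simp only [hT.zero]
    exact ContinuousLinearMap.adjoint_id
  have hpair : ∀ h ∈ {h | ∃ k, IsAdjointPair A h k},
      ContinuousOn (fun t => (T t).adjoint h) (Ici 0) := by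
    rintro h ⟨k, hk⟩
    have hlip : ∀ s t : ℝ, 0 ≤ s → s ≤ t →
        ‖(T t).adjoint h - (T s).adjoint h‖ ≤ M * (M * ‖k‖) * |t - s| := by
      intro s t hs hst
      have h1 := hk.norm_sub_sub_le (c := 0) hT hG hd (τ := t - s) (C := M * ‖k‖)
        (sub_nonneg.2 hst) (by positivity) (fun r hr => by
          rw [sub_zero]; exact ContinuousLinearMap.le_of_opNorm_le _ (hMa r hr.1) k)
      rw [smul_zero, sub_zero] at h1
      have h2 : (T t).adjoint h - (T s).adjoint h
          = (T s).adjoint ((T (t - s)).adjoint h - h) := by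
        rw [map_sub, ← ContinuousLinearMap.comp_apply, ← hadd s (t - s) hs (sub_nonneg.2 hst),
          add_sub_cancel]
      rw [h2, abs_of_nonneg (sub_nonneg.2 hst), mul_assoc]
      refine (ContinuousLinearMap.le_of_opNorm_le _ (hMa s hs) _).trans ?_
      gcongr
    refine LipschitzOnWith.continuousOn (K := Real.toNNReal (M * (M * ‖k‖))) ?_
    refine LipschitzOnWith.of_dist_le_mul fun s hs t ht => ?_
    rw [Real.coe_toNNReal _ (by positivity), dist_eq_norm, Real.dist_eq]
    rcases le_total s t with hst | hst
    · rw [norm_sub_rev, abs_sub_comm]; exact hlip s t hs hst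
    · exact hlip t s ht hst
  -- By the uniform bound `M`, a general orbit is a uniform limit of the Lipschitz orbits starting
  -- in the dense set `hd'`.
  refine continuousOn_of_uniform_approx_of_continuousOn fun U hU => ?_
  obtain ⟨ε, hε, hεU⟩ := Metric.mem_uniformity_dist.1 hU
  obtain ⟨g, hg, hgε⟩ := Metric.dense_iff.1 hd' h (ε / (M + 1)) (by positivity)
  refine ⟨fun t => (T t).adjoint g, hpair g hgε, fun t ht => hεU ?_⟩
  rw [dist_eq_norm, ← map_sub]
  calc ‖(T t).adjoint (h - g)‖ ≤ M * ‖h - g‖ :=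
        ContinuousLinearMap.le_of_opNorm_le _ (hMa t ht) _
    _ ≤ (M + 1) * ‖h - g‖ := by gcongr; linarith
    _ < (M + 1) * (ε / (M + 1)) := by
        gcongr
        rwa [Metric.mem_ball, dist_comm, dist_eq_norm] at hg
    _ = ε := by field_simp

theorem IsAdjointPair.tendsto {h k : L2} (hk : IsAdjointPair A h k) (hT : IsC0Semigroup T)
    (hG : IsGenerator A T) (hd : Dense (A.domain : Set L2))
    (hTa : IsC0Semigroup fun t => (T t).adjoint) :
    Tendsto (fun t : ℝ => ((t⁻¹ : ℝ) : ℂ) • ((T t).adjoint h - h)) (𝓝[>] 0) (𝓝 k) := by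
  rw [Metric.tendsto_nhdsWithin_nhds]
  intro ε hε
  have hc := hTa.cont k 0 self_mem_Ici
  rw [Metric.continuousWithinAt_iff] at hc
  obtain ⟨δ, hδ, hb⟩ := hc (ε / 2) (by positivity)
  refine ⟨δ, hδ, fun {t} ht htδ => ?_⟩
  have ht' : 0 < t := ht
  rw [Real.dist_eq, sub_zero, abs_of_pos ht'] at htδ
  have h1 := hk.norm_sub_sub_le (c := k) hT hG hd (τ := t) (C := ε / 2) ht'.le (by positivity)
    (fun s hs => by
      have := hb (x := s) hs.1 (by
        rw [Real.dist_eq, sub_zero, abs_of_nonneg hs.1]; exact hs.2.trans htδ)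
      simp only [hTa.zero, one_apply_eq_self, dist_eq_norm] at this
      exact this.le)
  have h2 : ((t⁻¹ : ℝ) : ℂ) • ((T t).adjoint h - h) - k
      = ((t⁻¹ : ℝ) : ℂ) • ((T t).adjoint h - h - (t : ℂ) • k) := by
    rw [smul_sub _ _ ((t : ℂ) • k), smul_smul, ← Complex.ofReal_mul, inv_mul_cancel₀ ht'.ne',
      Complex.ofReal_one, one_smul]
  rw [dist_eq_norm, h2, norm_smul, Complex.norm_real, Real.norm_eq_abs, abs_of_pos (inv_pos.2 ht')]
  calc _ ≤ t⁻¹ * (ε / 2 * t) := by gcongr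
    _ = ε / 2 := by field_simp
    _ < ε := by linarith

end AdjointSemigroup

/-! ### Energy identities along the adjoint semigroup -/

section Energy

variable {A : L2 →ₗ.[ℂ] L2} {T : ℝ → L2 →L[ℂ] L2} {P : L2 →L[ℂ] L2} {φ ψ : L2 → ℝ}

theorem continuous_energy (P : L2 →L[ℂ] L2) : Continuous fun h => (inner ℂ (P h) h : ℂ).re :=
  Complex.continuous_re.comp (P.continuous.inner continuous_id)

/-- Fundamental theorem of calculus for `⟨P u, u⟩`. The argument is clamped to `max t 0` because
semigroups are arbitrary at negative times, while a globally continuous integrand is convenient. -/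
theorem integral_eq_energy_sub {u v : ℝ → L2} {F : ℝ → ℝ}
    (hF : Continuous fun t => F (max t 0)) (hu : ContinuousOn u (Ici 0))
    (hd : ∀ s, 0 ≤ s → HasDerivWithinAt u (v s) (Ici s) s)
    (hP : ∀ s, 0 ≤ s → (inner ℂ (P (u s)) (v s) + inner ℂ (P (v s)) (u s) : ℂ).re = -F s)
    {τ : ℝ} (hτ : 0 ≤ τ) :
    ∫ t in (0 : ℝ)..τ, F (max t 0) =
      (inner ℂ (P (u 0)) (u 0) : ℂ).re - (inner ℂ (P (u τ)) (u τ) : ℂ).re := by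
  have hder : ∀ s ∈ Ioo (min 0 τ) (max 0 τ), HasDerivWithinAt
      (fun s => (inner ℂ (P (u s)) (u s) : ℂ).re) (-F (max s 0)) (Ioi s) s := by
    intro s hs0
    rw [min_eq_left hτ, max_eq_right hτ] at hs0
    have h1 := hd s hs0.1.le
    have h2 : HasDerivWithinAt (fun s => P (u s)) (P (v s)) (Ici s) s :=
      (P.restrictScalars ℝ).hasFDerivAt.comp_hasDerivWithinAt s h1
    have h3 := Complex.reCLM.hasFDerivAt.comp_hasDerivWithinAt s (h2.inner ℂ h1)
    rw [max_eq_left hs0.1.le, ← hP s hs0.1.le]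
    exact h3.mono Ioi_subset_Ici_self
  have hcont : ContinuousOn (fun s => (inner ℂ (P (u s)) (u s) : ℂ).re) (uIcc 0 τ) := by
    rw [uIcc_of_le hτ]
    exact (continuous_energy P).comp_continuousOn (hu.mono Icc_subset_Ici_self)
  have h4 := intervalIntegral.integral_eq_sub_of_hasDeriv_right hcont hder
    (hF.neg.intervalIntegrable _ _)
  rw [intervalIntegral.integral_neg] at h4
  linarith

/-- The integrated Lyapunov equation along the adjoint semigroup. -/
theorem IsC0Semigroup.energy_identity (hT : IsC0Semigroup T) (hG : IsGenerator A T)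
    (hd : Dense (A.domain : Set L2)) (hd' : Dense {h | ∃ k, IsAdjointPair A h k})
    (hs : IsExponentiallyStable T) (hφ : Continuous φ)
    (hP : ∀ h k, IsAdjointPair A h k → (inner ℂ (P h) k + inner ℂ (P k) h : ℂ).re = -φ h)
    (h : L2) {τ : ℝ} (hτ : 0 ≤ τ) :
    (inner ℂ (P h) h : ℂ).re =
      (inner ℂ (P ((T τ).adjoint h)) ((T τ).adjoint h) : ℂ).re +
        ∫ t in (0 : ℝ)..τ, φ ((T (max t 0)).adjoint h) := by
  obtain ⟨M, hM0, hM⟩ := hs.exists_bound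
  have hTa := hT.adjoint hG hd hd' hM0 hM
  have hj : Continuous fun p : L2 × ℝ => (T (max p.2 0)).adjoint p.1 :=
    continuous_uncurry_of_bounded (T := fun t => (T t).adjoint)
      (fun t ht => by rw [LinearIsometryEquiv.norm_map]; exact hM t ht) hTa.cont
  have hint : Continuous fun h : L2 => ∫ t in (0 : ℝ)..τ, φ ((T (max t 0)).adjoint h) :=
    intervalIntegral.continuous_parametric_intervalIntegral_of_continuous'
      (f := fun h t => φ ((T (max t 0)).adjoint h)) (hφ.comp hj) 0 τ
  have hE := continuous_energy P
  -- Both sides are continuous in `h`, so it suffices to treat the domain of the adjoint, where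
  -- orbits are differentiable.
  have hcl : IsClosed {h : L2 | (inner ℂ (P h) h : ℂ).re =
      (inner ℂ (P ((T τ).adjoint h)) ((T τ).adjoint h) : ℂ).re +
        ∫ t in (0 : ℝ)..τ, φ ((T (max t 0)).adjoint h)} :=
    isClosed_eq hE ((hE.comp ((T τ).adjoint).continuous).add hint)
  have hpair : {h | ∃ k, IsAdjointPair A h k} ⊆ {h : L2 | (inner ℂ (P h) h : ℂ).re =
      (inner ℂ (P ((T τ).adjoint h)) ((T τ).adjoint h) : ℂ).re +
        ∫ t in (0 : ℝ)..τ, φ ((T (max t 0)).adjoint h)} := by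
    rintro h ⟨k, hk⟩
    have hTh : ∀ s : ℝ, 0 ≤ s →
        HasDerivWithinAt (fun t => (T t).adjoint h) ((T s).adjoint k) (Ici s) s := fun s hs =>
      hTa.hasDerivWithinAt (hk.tendsto hT hG hd hTa) hs
    have hcφ : Continuous fun t => φ ((T (max t 0)).adjoint h) :=
      hφ.comp ((hTa.cont h).comp_continuous (continuous_id.max continuous_const)
        fun s => mem_Ici.2 (le_max_right _ _))
    have h4 := integral_eq_energy_sub (P := P) (τ := τ) (u := fun t => (T t).adjoint h)
      (v := fun t => (T t).adjoint k) (F := fun t => φ ((T t).adjoint h)) hcφ (hTa.cont h) hTh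
      (fun s hs => hP _ _ (hk.semigroup hT hG hs)) hτ
    have h5 : (T 0).adjoint h = h := by simpa using congr($(hTa.zero) h)
    rw [h5] at h4
    rw [mem_ofPred_eq, h4]
    ring
  exact hcl.closure_subset_iff.2 hpair (hd' h)

theorem IsExponentiallyStable.tendsto_energy (hs : IsExponentiallyStable T) (P : L2 →L[ℂ] L2)
    (h : L2) : Tendsto (fun τ : ℝ =>
      (inner ℂ (P ((T τ).adjoint h)) ((T τ).adjoint h) : ℂ).re) atTop (𝓝 0) := by
  have h1 : Tendsto (fun τ : ℝ => (T τ).adjoint h) atTop (𝓝 0) := by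
    refine squeeze_zero_norm (fun τ => ?_)
      (by simpa using hs.tendsto_norm.mul_const ‖h‖ : Tendsto (fun τ => ‖T τ‖ * ‖h‖) atTop (𝓝 0))
    exact ContinuousLinearMap.le_of_opNorm_le _ (by rw [LinearIsometryEquiv.norm_map]) h
  have h2 := ((continuous_energy P).tendsto 0).comp h1
  rwa [inner_zero_right, Complex.zero_re] at h2

theorem ofReal_intervalIntegral_eq_lintegral {f : ℝ → ℝ} (hf : Continuous f) (h0 : ∀ t, 0 ≤ f t)
    {τ : ℝ} (hτ : 0 ≤ τ) :
    ENNReal.ofReal (∫ t in (0 : ℝ)..τ, f t) = ∫⁻ t in Ioc 0 τ, ENNReal.ofReal (f t) := by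
  rw [intervalIntegral.integral_of_le hτ]
  exact ofReal_integral_eq_lintegral_ofReal
    ((hf.intervalIntegrable 0 τ).1) (Eventually.of_forall h0)

theorem setLIntegral_max (T : ℝ → L2 →L[ℂ] L2) (ψ : L2 → ℝ) (h : L2) :
    ∫⁻ t in Ioi (0 : ℝ), ENNReal.ofReal (ψ ((T t).adjoint h)) =
      ∫⁻ t in Ioi (0 : ℝ), ENNReal.ofReal (ψ ((T (max t 0)).adjoint h)) :=
  setLIntegral_congr_fun measurableSet_Ioi fun t ht => by
    simp only [max_eq_left (le_of_lt (mem_Ioi.1 ht))]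

theorem IsC0Semigroup.continuous_adjoint_orbit (hT : IsC0Semigroup T) (hG : IsGenerator A T)
    (hd : Dense (A.domain : Set L2)) (hd' : Dense {h | ∃ k, IsAdjointPair A h k})
    (hs : IsExponentiallyStable T) (h : L2) : Continuous fun t => (T (max t 0)).adjoint h := by
  obtain ⟨M, hM0, hM⟩ := hs.exists_bound
  exact ((hT.adjoint hG hd hd' hM0 hM).cont h).comp_continuous (by fun_prop)
    fun s => mem_Ici.2 (le_max_right _ _)

/-- The dissipation rate `φ` may change sign, so it is replaced by its nonnegative majorant `ψ`
before `τ → ∞`; the boundary term vanishes by stability. -/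
theorem IsC0Semigroup.ofReal_energy_le (hT : IsC0Semigroup T) (hG : IsGenerator A T)
    (hd : Dense (A.domain : Set L2)) (hd' : Dense {h | ∃ k, IsAdjointPair A h k})
    (hs : IsExponentiallyStable T) (hφ : Continuous φ)
    (hP : ∀ h k, IsAdjointPair A h k → (inner ℂ (P h) k + inner ℂ (P k) h : ℂ).re = -φ h)
    (hψ : Continuous ψ) (hψ0 : ∀ h, 0 ≤ ψ h) (hle : ∀ h, φ h ≤ ψ h) (h : L2) :
    ENNReal.ofReal (inner ℂ (P h) h : ℂ).re ≤
      ∫⁻ t in Ioi (0 : ℝ), ENNReal.ofReal (ψ ((T t).adjoint h)) := by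
  have hc := hT.continuous_adjoint_orbit hG hd hd' hs h
  rw [setLIntegral_max]
  set V := ∫⁻ t in Ioi (0 : ℝ), ENNReal.ofReal (ψ ((T (max t 0)).adjoint h)) with hV
  have h1 : Tendsto (fun τ : ℝ => ENNReal.ofReal
      (inner ℂ (P ((T τ).adjoint h)) ((T τ).adjoint h) : ℂ).re + V) atTop (𝓝 (0 + V)) := by
    refine Tendsto.add ?_ tendsto_const_nhds
    simpa using ENNReal.tendsto_ofReal (hs.tendsto_energy P h)
  rw [zero_add] at h1
  refine ge_of_tendsto h1 ?_
  filter_upwards [eventually_ge_atTop 0] with τ hτ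
  rw [hT.energy_identity hG hd hd' hs hφ hP h hτ]
  -- Subadditivity of `ENNReal.ofReal` suffices, whatever the signs of the boundary term and the
  -- integral.
  refine ENNReal.ofReal_add_le.trans (add_le_add le_rfl ?_)
  calc ENNReal.ofReal (∫ t in (0 : ℝ)..τ, φ ((T (max t 0)).adjoint h))
      ≤ ENNReal.ofReal (∫ t in (0 : ℝ)..τ, ψ ((T (max t 0)).adjoint h)) :=
        ENNReal.ofReal_le_ofReal (intervalIntegral.integral_mono hτ
          ((hφ.comp hc).intervalIntegrable _ _) ((hψ.comp hc).intervalIntegrable _ _)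
          fun t => hle _)
    _ = ∫⁻ t in Ioc 0 τ, ENNReal.ofReal (ψ ((T (max t 0)).adjoint h)) :=
        ofReal_intervalIntegral_eq_lintegral (hψ.comp hc) (fun t => hψ0 _) hτ
    _ ≤ V := lintegral_mono_set Ioc_subset_Ioi_self

theorem IsC0Semigroup.lintegral_eq_ofReal_energy (hT : IsC0Semigroup T) (hG : IsGenerator A T)
    (hd : Dense (A.domain : Set L2)) (hd' : Dense {h | ∃ k, IsAdjointPair A h k})
    (hs : IsExponentiallyStable T) (hφ : Continuous φ)
    (hP : ∀ h k, IsAdjointPair A h k → (inner ℂ (P h) k + inner ℂ (P k) h : ℂ).re = -φ h)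
    (hφ0 : ∀ h, 0 ≤ φ h) (h : L2) :
    ∫⁻ t in Ioi (0 : ℝ), ENNReal.ofReal (φ ((T t).adjoint h)) =
      ENNReal.ofReal (inner ℂ (P h) h : ℂ).re := by
  have hc := hT.continuous_adjoint_orbit hG hd hd' hs h
  rw [setLIntegral_max]
  have h1 := (aecover_Iic (μ := volume.restrict (Ioi (0 : ℝ)))
    tendsto_id).lintegral_tendsto_of_countably_generated
    (f := fun t => ENNReal.ofReal (φ ((T (max t 0)).adjoint h)))
    ((hφ.comp hc).measurable.ennreal_ofReal.aemeasurable)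
  have h2 : Tendsto (fun τ : ℝ => ENNReal.ofReal ((inner ℂ (P h) h : ℂ).re -
      (inner ℂ (P ((T τ).adjoint h)) ((T τ).adjoint h) : ℂ).re)) atTop
      (𝓝 (ENNReal.ofReal (inner ℂ (P h) h : ℂ).re)) := by
    simpa using ENNReal.tendsto_ofReal (tendsto_const_nhds.sub (hs.tendsto_energy P h))
  refine tendsto_nhds_unique h1 (h2.congr' ?_)
  filter_upwards [eventually_ge_atTop 0] with τ hτ
  rw [hT.energy_identity hG hd hd' hs hφ hP h hτ, add_sub_cancel_left,
    ofReal_intervalIntegral_eq_lintegral (f := fun t => φ ((T (max t 0)).adjoint h))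
      (hφ.comp hc) (fun t => hφ0 _) hτ,
    Measure.restrict_restrict measurableSet_Iic, inter_comm, Ioi_inter_Iic]
  rfl

end Energy

/-! ### Fourier multipliers and the Riccati identity -/

section Fourier

theorem HasFourierSymbol.eq {T : L2 →L[ℂ] L2} {m : ℝ → ℂ} (hm : HasFourierSymbol (ofCLM T) m)
    (f : L2) :
    (𝓕 (T f) : L2) =ᵐ[volume] fun ξ : ℝ => m (2 * Real.pi * ξ) * (𝓕 f : L2) ξ :=
  hm ⟨f, trivial⟩

theorem inner_eq_integral_fourier (f g : L2) :
    (inner ℂ f g : ℂ) =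
      ∫ ξ, starRingEnd ℂ ((𝓕 f : L2) ξ) * (𝓕 g : L2) ξ := by
  rw [← Lp.inner_fourier_eq, L2.inner_def]
  simp only [RCLike.inner_apply, mul_comm]

theorem integrable_fourier_inner (f g : L2) :
    Integrable fun ξ => starRingEnd ℂ ((𝓕 f : L2) ξ) * (𝓕 g : L2) ξ := by
  have := L2.integrable_inner (𝕜 := ℂ) (𝓕 f : L2) (𝓕 g : L2)
  simpa only [RCLike.inner_apply, mul_comm] using this

/-- Multiplying the transform of `f` by the conjugate symbol gives an `L²` function, having the same
modulus as the transform of `T f`. Plancherel identifies its inverse transform with `T* f`, so no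
bound on `m` is needed. -/
theorem HasFourierSymbol.adjoint {T : L2 →L[ℂ] L2} {m : ℝ → ℂ}
    (hm : HasFourierSymbol (ofCLM T) m) (hmeas : Measurable m) :
    HasFourierSymbol (ofCLM T.adjoint) fun x => starRingEnd ℂ (m x) := by
  rintro ⟨f, -⟩
  change (𝓕 (T.adjoint f) : L2) =ᵐ[volume]
    fun ξ : ℝ => starRingEnd ℂ (m (2 * Real.pi * ξ)) * (𝓕 f : L2) ξ
  have hmem : MemLp (fun ξ : ℝ => starRingEnd ℂ (m (2 * Real.pi * ξ)) * (𝓕 f : L2) ξ) 2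
      volume := by
    refine (Lp.memLp (𝓕 (T f) : L2)).congr_norm ?_ ?_
    · refine AEStronglyMeasurable.mul ?_ (Lp.aestronglyMeasurable _)
      have : Measurable fun ξ : ℝ => starRingEnd ℂ (m (2 * Real.pi * ξ)) :=
        Complex.continuous_conj.measurable.comp (hmeas.comp (measurable_const_mul _))
      exact this.aestronglyMeasurable
    · filter_upwards [hm.eq f] with ξ hξ
      rw [hξ, norm_mul, norm_mul, RCLike.norm_conj]
  have hw : T.adjoint f = 𝓕⁻ (hmem.toLp _) := by
    refine ext_inner_right ℂ fun u => ?_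
    rw [ContinuousLinearMap.adjoint_inner_left, inner_eq_integral_fourier,
      inner_eq_integral_fourier, FourierTransform.fourier_fourierInv_eq]
    refine integral_congr_ae ?_
    filter_upwards [hm.eq u, hmem.coeFn_toLp] with ξ h1 h2
    rw [h1, h2]
    simp only [map_mul, Complex.conj_conj]
    ring
  rw [hw, FourierTransform.fourier_fourierInv_eq]
  exact hmem.coeFn_toLp

theorem HasFourierSymbol.comp_adjoint {T : L2 →L[ℂ] L2} {m : ℝ → ℂ}
    (hm : HasFourierSymbol (ofCLM T) m) (hmeas : Measurable m) (f : L2) :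
    (𝓕 (T (T.adjoint f)) : L2) =ᵐ[volume]
      fun ξ : ℝ => ((‖m (2 * Real.pi * ξ)‖ ^ 2 : ℝ) : ℂ) * (𝓕 f : L2) ξ := by
  filter_upwards [hm.eq (T.adjoint f), (hm.adjoint hmeas).eq f] with ξ h1 h2
  rw [h1, h2, ← mul_assoc, Complex.mul_conj, Complex.normSq_eq_norm_sq]

theorem HasFourierSymbol.eq_of_mem_graph {A : L2 →ₗ.[ℂ] L2} {a : ℝ → ℂ}
    (ha : HasFourierSymbol A a) {f g : L2} (h : (f, g) ∈ A.graph) :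
    (𝓕 g : L2) =ᵐ[volume] fun ξ : ℝ => a (2 * Real.pi * ξ) * (𝓕 f : L2) ξ := by
  obtain ⟨x, hx1, hx2⟩ := (LinearPMap.mem_graph_iff _).1 h
  simp only at hx1 hx2
  rw [← hx1, ← hx2]
  exact ha x

theorem HasFourierSymbol.re_inner_le {A : L2 →ₗ.[ℂ] L2} {a : ℝ → ℂ} (ha : HasFourierSymbol A a)
    {ω : ℝ} (hω : ∀ x, (a x).re ≤ ω) (u : A.domain) :
    (inner ℂ (u : L2) (A u) : ℂ).re ≤ ω * ‖(u : L2)‖ ^ 2 := by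
  have h1 : ω * ‖(u : L2)‖ ^ 2 = ((ω : ℂ) * inner ℂ (u : L2) (u : L2) : ℂ).re := by
    rw [inner_self_eq_norm_sq_to_K, Complex.re_ofReal_mul]
    simp [← Complex.ofReal_pow]
  rw [h1, inner_eq_integral_fourier, inner_eq_integral_fourier, ← integral_const_mul]
  have hi1 := integrable_fourier_inner (u : L2) (A u)
  have hi2 := (integrable_fourier_inner (u : L2) u).const_mul (ω : ℂ)
  have e1 := integral_re (𝕜 := ℂ) hi1
  have e2 := integral_re (𝕜 := ℂ) hi2
  refine e1.symm.le.trans (le_trans (integral_mono_ae hi1.re hi2.re ?_) e2.le)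
  filter_upwards [ha u] with ξ hξ
  simp only [RCLike.re_to_complex]
  rw [hξ, mul_left_comm, mul_comm (starRingEnd ℂ _), Complex.mul_conj, Complex.re_mul_ofReal,
    Complex.re_mul_ofReal, Complex.ofReal_re]
  exact mul_le_mul_of_nonneg_right (hω _) (Complex.normSq_nonneg _)

/-- The symbol of the adjoint of a multiplier with boundedly invertible shift. -/
theorem IsAdjointPair.fourier_eq {A : L2 →ₗ.[ℂ] L2} {R : L2 →L[ℂ] L2} {a : ℝ → ℂ} {l : ℝ}
    (ha : HasFourierSymbol A a) (hmeas : Measurable a) (hl : ∀ x, a x - l ≠ 0)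
    (hR : ∀ f, (R f, f) ∈ (A - ofCLM ((l : ℂ) • 1)).graph) {h k : L2}
    (hk : IsAdjointPair A h k) :
    (𝓕 k : L2) =ᵐ[volume]
      fun ξ : ℝ => starRingEnd ℂ (a (2 * Real.pi * ξ)) * (𝓕 h : L2) ξ := by
  -- The unbounded adjoint is reached through the bounded inverse `R` of `A - ℓ`: conjugate the
  -- symbol of `R`, then invert `h = R*(k - ℓh)`.
  have hsymb : HasFourierSymbol (ofCLM R) fun x => (a x - l)⁻¹ := by
    rintro ⟨f, -⟩
    change (𝓕 (R f) : L2) =ᵐ[volume]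
      fun ξ : ℝ => (a (2 * Real.pi * ξ) - l)⁻¹ * (𝓕 f : L2) ξ
    have h1 := ha.eq_of_mem_graph (mem_graph_sub_ofCLM.1 (hR f))
    have h2 : (𝓕 (f + ((l : ℂ) • (1 : L2 →L[ℂ] L2)) (R f)) : L2)
        = 𝓕 f + (l : ℂ) • 𝓕 (R f) := by
      rw [FourierTransform.fourier_add, _root_.smul_apply, one_apply_eq_self,
        FourierTransform.fourier_smul]
    rw [h2] at h1
    filter_upwards [h1, Lp.coeFn_add (𝓕 f : L2) ((l : ℂ) • 𝓕 (R f)),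
      Lp.coeFn_smul (l : ℂ) (𝓕 (R f) : L2)] with ξ h3 h4 h5
    rw [h4, Pi.add_apply, h5, Pi.smul_apply, smul_eq_mul] at h3
    rw [eq_inv_mul_iff_mul_eq₀ (hl _), sub_mul, ← h3]
    ring
  have hk' := isAdjointPair_sub_ofCLM (K := (l : ℂ) • 1) hk
  have h1 := hk'.adjoint_inverse_apply hR
  have h2 : k - ((l : ℂ) • (1 : L2 →L[ℂ] L2)).adjoint h = k - (l : ℂ) • h := by
    congr 1
    refine ext_inner_right ℂ fun u => ?_
    rw [ContinuousLinearMap.adjoint_inner_left, _root_.smul_apply, one_apply_eq_self,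
      inner_smul_left, inner_smul_right, Complex.conj_ofReal]
  rw [h2] at h1
  have hmeas' : Measurable fun x => (a x - l)⁻¹ := (hmeas.sub_const _).inv
  have h3 := (hsymb.adjoint hmeas').eq (k - (l : ℂ) • h)
  have h4 : (𝓕 (k - (l : ℂ) • h) : L2) = 𝓕 k - (l : ℂ) • 𝓕 h := by
    rw [sub_eq_add_neg, FourierTransform.fourier_add, ← neg_smul, FourierTransform.fourier_smul,
      neg_smul, ← sub_eq_add_neg]
  rw [h1, h4] at h3
  filter_upwards [h3, Lp.coeFn_sub (𝓕 k : L2) ((l : ℂ) • 𝓕 h),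
    Lp.coeFn_smul (l : ℂ) (𝓕 h : L2)] with ξ h5 h6 h7
  rw [h6, Pi.sub_apply, h7, Pi.smul_apply, smul_eq_mul, map_inv₀,
    eq_inv_mul_iff_mul_eq₀ ((map_ne_zero _).2 (hl _)), map_sub, Complex.conj_ofReal, sub_mul] at h5
  linear_combination -h5

theorem integral_add_add_sub_eq_zero {F₁ F₂ F₃ F₄ : ℝ → ℂ} (h₁ : Integrable F₁)
    (h₂ : Integrable F₂) (h₃ : Integrable F₃) (h₄ : Integrable F₄)
    (h : ∀ᵐ x, F₁ x + F₂ x + F₃ x - F₄ x = 0) :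
    (∫ x, F₁ x) + (∫ x, F₂ x) + (∫ x, F₃ x) - (∫ x, F₄ x) = 0 := by
  rw [← integral_add h₁ h₂, ← integral_add (f := fun x => F₁ x + F₂ x) (h₁.add h₂) h₃,
    ← integral_sub (f := fun x => F₁ x + F₂ x + F₃ x) ((h₁.add h₂).add h₃) h₄]
  exact integral_eq_zero_of_ae h

/-- The Riccati identity for multipliers satisfying the matching condition. -/
theorem riccati_identity {B G : L2 →L[ℂ] L2} {a b g : ℝ → ℂ} {l : ℝ}
    (hB : HasFourierSymbol (ofCLM B) b) (hG : HasFourierSymbol (ofCLM G) g)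
    (hb : Measurable b) (hg : Measurable g)
    (hmatch : ∀ x : ℝ, ‖b x‖ ^ 2 = l * (l - 2 * (a x).re) * ‖g x‖ ^ 2) {f f' h h' : L2}
    (hf : (𝓕 f' : L2) =ᵐ[volume]
      fun ξ : ℝ => starRingEnd ℂ (a (2 * Real.pi * ξ)) * (𝓕 f : L2) ξ)
    (hh : (𝓕 h' : L2) =ᵐ[volume]
      fun ξ : ℝ => starRingEnd ℂ (a (2 * Real.pi * ξ)) * (𝓕 h : L2) ξ) :
    (l : ℂ) * inner ℂ f' (G (G.adjoint h)) + (l : ℂ) * inner ℂ f (G (G.adjoint h')) +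
      inner ℂ f (B (B.adjoint h)) - (l : ℂ) ^ 2 * inner ℂ f (G (G.adjoint h)) = 0 := by
  have hi := integrable_fourier_inner
  simp only [inner_eq_integral_fourier, ← integral_const_mul]
  refine integral_add_add_sub_eq_zero ((hi _ _).const_mul _) ((hi _ _).const_mul _) (hi _ _)
    ((hi _ _).const_mul _) ?_
  filter_upwards [hf, hh, hG.comp_adjoint hg h, hG.comp_adjoint hg h', hB.comp_adjoint hb h]
    with ξ e1 e2 e3 e4 e5
  rw [e1, e3, e4, e5, e2, hmatch]
  have hre : ((a (2 * Real.pi * ξ)).re : ℂ) * 2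
      = a (2 * Real.pi * ξ) + starRingEnd ℂ (a (2 * Real.pi * ξ)) := by
    rw [Complex.add_conj]; push_cast; ring
  simp only [map_mul, Complex.conj_conj, Complex.ofReal_mul, Complex.ofReal_sub,
    Complex.ofReal_ofNat]
  -- After matching, the only remainder is `a + ā - 2 Re a`, with this factor up to sign.
  linear_combination (-(l : ℂ) * ((‖g (2 * Real.pi * ξ)‖ ^ 2 : ℝ) : ℂ) *
    starRingEnd ℂ ((𝓕 f : L2) ξ) * (𝓕 h : L2) ξ) * hre

theorem IsProperRational.measurable {m : ℝ → ℂ} (hm : IsProperRational m) : Measurable m := by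
  obtain ⟨q, r, -, -, -, h⟩ := hm
  rw [funext h]
  have hp : ∀ p : Polynomial ℂ, Measurable fun x : ℝ => p.eval (x : ℂ) := fun p =>
    (p.continuous.comp Complex.continuous_ofReal).measurable
  exact (hp q).div (hp r)

theorem IsProperRational.ne_zero {m : ℝ → ℂ} (hm : IsProperRational m) (x : ℝ) : m x ≠ 0 := by
  obtain ⟨q, r, -, hq, hr, h⟩ := hm
  rw [h]
  exact div_ne_zero (hq _) (hr _)

end Fourier

/-! ### Intertwining of stable semigroups -/

/-- The hypothesis is the homogeneous Sylvester equation `D X + X A* = 0`. It makes the derivative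
of `U(t) X T(t)*h` vanish, so this curve stays at `X h`, while stability drives it to zero. -/
theorem eq_zero_of_intertwines {A D : L2 →ₗ.[ℂ] L2} {T U : ℝ → L2 →L[ℂ] L2} {X : L2 →L[ℂ] L2}
    (hT : IsC0Semigroup T) (hG : IsGenerator A T) (hs : IsExponentiallyStable T)
    (hd : Dense (A.domain : Set L2)) (hd' : Dense {h | ∃ k, IsAdjointPair A h k})
    (hU : IsC0Semigroup U) (hGU : IsGenerator D U) (hsU : IsExponentiallyStable U)
    (hX : ∀ h k, IsAdjointPair A h k → (X h, -X k) ∈ D.graph) : X = 0 := by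
  obtain ⟨M, hM0, hM⟩ := hs.exists_bound
  obtain ⟨M', hM0', hM'⟩ := hsU.exists_bound
  have hTa := hT.adjoint hG hd hd' hM0 hM
  have hpair : {h | ∃ k, IsAdjointPair A h k} ⊆ {h | X h = 0} := by
    rintro h ⟨k, hk⟩
    have hderT : ∀ s : ℝ, 0 ≤ s →
        HasDerivWithinAt (fun t => X ((T t).adjoint h)) (X ((T s).adjoint k)) (Ici s) s := by
      intro s hs0
      have h1 : HasDerivWithinAt (fun t => (T t).adjoint h) ((T s).adjoint k) (Ici s) s :=
        hTa.hasDerivWithinAt (hk.tendsto hT hG hd hTa) hs0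
      exact (X.restrictScalars ℝ).hasFDerivAt.comp_hasDerivWithinAt s h1
    have hderiv : ∀ s : ℝ, 0 ≤ s →
        HasDerivWithinAt (fun t => U t (X ((T t).adjoint h))) 0 (Ici s) s := by
      intro s hs0
      have h1 := hU.hasDerivWithinAt ((hGU _ _).1 (hX _ _ (hk.semigroup hT hG hs0))) hs0
      have h2 := hasDerivWithinAt_apply hM' hU.cont hs0 (hderT s hs0) h1
      simpa using h2
    have hcont : ContinuousOn (fun t => U t (X ((T t).adjoint h))) (Ici 0) := by
      have h1 : ContinuousOn (fun t => X ((T t).adjoint h)) (Ici 0) :=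
        X.continuous.comp_continuousOn (hTa.cont h)
      have h2 := (continuous_uncurry_of_bounded hM' hU.cont).comp_continuousOn
        (h1.prodMk continuousOn_id)
      refine h2.congr fun t ht => ?_
      simp only [Function.comp_apply, id, max_eq_left (mem_Ici.1 ht)]
    have hconst : ∀ t : ℝ, 0 ≤ t → U t (X ((T t).adjoint h)) = X h := by
      intro t ht
      have h1 := constant_of_has_deriv_right_zero
        (hcont.mono (Icc_subset_Ici_self : Icc 0 t ⊆ Ici 0))
        (fun s hs0 => hderiv s hs0.1) t (right_mem_Icc.2 ht)
      have h5 : (T 0).adjoint h = h := by simpa using congr($(hTa.zero) h)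
      simpa only [hU.zero, h5, one_apply_eq_self] using h1
    have hlim : Tendsto (fun t : ℝ => ‖U t‖ * (‖X‖ * (M * ‖h‖))) atTop (𝓝 0) := by
      simpa using hsU.tendsto_norm.mul_const (‖X‖ * (M * ‖h‖))
    have hle : ‖X h‖ ≤ 0 := by
      refine ge_of_tendsto hlim ?_
      filter_upwards [eventually_ge_atTop 0] with t ht
      rw [← hconst t ht]
      refine (U t).le_opNorm_of_le (X.le_opNorm_of_le ?_)
      exact ContinuousLinearMap.le_of_opNorm_le _
        (by rw [LinearIsometryEquiv.norm_map]; exact hM t ht) h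
    exact norm_le_zero_iff.1 hle
  have hcl : IsClosed {h | X h = 0} := isClosed_eq X.continuous continuous_const
  ext1 h
  exact hcl.closure_subset_iff.2 hpair (hd' h)

theorem dense_domain_sub_ofCLM {A : L2 →ₗ.[ℂ] L2} (hd : Dense (A.domain : Set L2))
    (K : L2 →L[ℂ] L2) : Dense ((A - ofCLM K).domain : Set L2) :=
  hd.mono fun _ hf => ⟨hf, trivial⟩

theorem dense_isAdjointPair_sub_ofCLM {A : L2 →ₗ.[ℂ] L2}
    (hd : Dense {h | ∃ k, IsAdjointPair A h k}) (K : L2 →L[ℂ] L2) :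
    Dense {h | ∃ k, IsAdjointPair (A - ofCLM K) h k} := by
  refine hd.mono ?_
  rintro h ⟨k, hk⟩
  exact ⟨_, isAdjointPair_sub_ofCLM hk⟩

theorem adjoint_real_smul_one_apply (l : ℝ) (h : L2) :
    ((l : ℂ) • (1 : L2 →L[ℂ] L2)).adjoint h = (l : ℂ) • h := by
  refine ext_inner_right ℂ fun u => ?_
  rw [ContinuousLinearMap.adjoint_inner_left, _root_.smul_apply, one_apply_eq_self,
    inner_smul_left, inner_smul_right, Complex.conj_ofReal]

theorem adjoint_one : (1 : L2 →L[ℂ] L2).adjoint = 1 := ContinuousLinearMap.adjoint_id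

/-! ### Measurement noise and the Kalman gain -/

namespace Plant

variable {S : Plant}

/-- The covariance `G G*` of the measurement noise. -/
noncomputable abbrev noise (S : Plant) : L2 →L[ℂ] L2 := S.G ∘L S.G.adjoint

theorem inner_noise (f h : L2) :
    (inner ℂ f (S.noise h) : ℂ) = inner ℂ (S.G.adjoint f) (S.G.adjoint h) := by
  rw [ContinuousLinearMap.comp_apply, ContinuousLinearMap.adjoint_inner_left]

theorem inner_noise_left (f h : L2) : (inner ℂ (S.noise f) h : ℂ) = inner ℂ f (S.noise h) := by
  rw [inner_noise, ContinuousLinearMap.comp_apply, ← ContinuousLinearMap.adjoint_inner_right]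

section Noise

variable (hG : IsPositiveDefinite S.noise)
include hG

theorem noise_injective (f : L2) (hf : S.noise f = 0) : f = 0 := by
  by_contra h
  have := hG.2 f h
  rw [hf, inner_zero_left] at this
  exact lt_irrefl _ this

theorem denseRange_noise : DenseRange S.noise := by
  have := denseRange_adjoint (noise_injective hG)
  rwa [hG.1.isSelfAdjoint.adjoint_eq] at this

theorem mem_graph_noiseInv {f h : L2} : (f, h) ∈ S.noiseInv.graph ↔ S.noise h = f := by
  have hker : LinearMap.ker (ofCLM S.noise).toFun = ⊥ := by
    refine LinearMap.ker_eq_bot'.2 fun x hx => Subtype.ext (noise_injective hG x hx)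
  rw [noiseInv, LinearPMap.inverse_graph hker]
  constructor
  · rintro ⟨⟨x, y⟩, hxy, h1⟩
    obtain ⟨z, hz1, hz2⟩ := (LinearPMap.mem_graph_iff _).1 hxy
    simp only [LinearEquiv.coe_coe, LinearEquiv.prodComm_apply, Prod.swap_prod_mk,
      Prod.mk.injEq] at h1 hz1 hz2
    rw [← h1.1, ← h1.2, ← hz2, ← hz1]
    rfl
  · rintro rfl
    exact ⟨(h, S.noise h), (LinearPMap.mem_graph_iff _).2 ⟨⟨h, trivial⟩, rfl, rfl⟩, rfl⟩

theorem noiseInv_noise (h : L2) (hh : S.noise h ∈ S.noiseInv.domain) :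
    S.noiseInv ⟨S.noise h, hh⟩ = h := by
  have h1 := S.noiseInv.mem_graph ⟨S.noise h, hh⟩
  rw [mem_graph_noiseInv hG] at h1
  have h2 := noise_injective hG (S.noiseInv ⟨S.noise h, hh⟩ - h)
    (by rw [map_sub, h1, sub_self])
  exact sub_eq_zero.1 h2

theorem noise_mem_domain (h : L2) : S.noise h ∈ S.noiseInv.domain :=
  LinearPMap.mem_domain_of_mem_graph ((mem_graph_noiseInv hG).2 rfl)

theorem mem_graph_gain_of_noise (hC : S.C = 1) (P : L2 →L[ℂ] L2) (h : L2) :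
    (S.noise h, P h) ∈
      (((P ∘L S.C.adjoint : L2 →L[ℂ] L2) : L2 →ₗ[ℂ] L2).compPMap S.noiseInv).graph := by
  refine (LinearPMap.mem_graph_iff _).2 ⟨⟨S.noise h, noise_mem_domain hG h⟩, rfl, ?_⟩
  change P (S.C.adjoint (S.noiseInv ⟨S.noise h, noise_mem_domain hG h⟩)) = P h
  rw [noiseInv_noise hG, hC, adjoint_one, one_apply_eq_self]

/-- Valid for every `P`, closable gain or not, because `LinearPMap.closure` always extends the
operator. The uniqueness proof uses this for an unknown solution. -/
theorem mem_graph_kalmanGain (hC : S.C = 1) (P : L2 →L[ℂ] L2) (h : L2) :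
    (S.noise h, P h) ∈ (S.kalmanGain P).graph :=
  LinearPMap.le_graph_of_le (LinearPMap.le_closure _) (mem_graph_gain_of_noise hG hC P h)

theorem kalmanGain_smul_noise (hC : S.C = 1) (c : ℂ) :
    S.kalmanGain (c • S.noise) = ofCLM (c • 1) := by
  set K := (((c • S.noise) ∘L S.C.adjoint : L2 →L[ℂ] L2) : L2 →ₗ[ℂ] L2).compPMap S.noiseInv
    with hK
  have hmem : ∀ f g : L2, (f, g) ∈ (ofCLM (c • 1)).graph ↔ g = c • f := by
    intro f g
    rw [LinearPMap.mem_graph_iff]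
    constructor
    · rintro ⟨x, rfl, rfl⟩
      rfl
    · rintro rfl
      exact ⟨⟨f, trivial⟩, rfl, rfl⟩
  have hclosed : (ofCLM (c • 1)).IsClosed := by
    have : ((ofCLM (c • 1)).graph : Set (L2 × L2)) = {p | p.2 = c • p.1} := by
      ext ⟨f, g⟩
      exact hmem f g
    rw [LinearPMap.IsClosed, this]
    exact isClosed_eq continuous_snd (continuous_fst.const_smul c)
  have hle : K ≤ ofCLM (c • 1) := by
    refine LinearPMap.le_of_le_graph ?_
    rintro ⟨f, g⟩ hfg
    obtain ⟨x, hx1, hx2⟩ := (LinearPMap.mem_graph_iff _).1 hfg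
    have h1 := (mem_graph_noiseInv hG).1 (S.noiseInv.mem_graph x)
    simp only at hx1 hx2
    rw [hmem, ← hx1, ← hx2]
    change c • S.noise (S.C.adjoint (S.noiseInv x)) = _
    rw [hC, adjoint_one, one_apply_eq_self, h1]
  -- Closability must be proved: on a non-closable operator `LinearPMap.closure` defaults to the
  -- operator itself.
  have hcl : K.IsClosable := hclosed.isClosable.leIsClosable hle
  refine LinearPMap.eq_of_eq_graph ?_
  rw [kalmanGain, ← hK, ← hcl.graph_closure_eq_closure_graph]
  refine le_antisymm (Submodule.topologicalClosure_minimal _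
    (LinearPMap.le_graph_of_le hle) hclosed) ?_
  rintro ⟨f, g⟩ hfg
  obtain rfl := (hmem f g).1 hfg
  have hcont : Continuous fun f : L2 => (f, c • f) :=
    continuous_id.prodMk (continuous_id.const_smul c)
  have hcl' : IsClosed {f : L2 | (f, c • f) ∈ K.graph.topologicalClosure} :=
    (Submodule.isClosed_topologicalClosure _).preimage hcont
  refine hcl'.closure_subset_iff.2 ?_ (denseRange_noise hG f)
  rintro _ ⟨h, rfl⟩
  exact Submodule.le_topologicalClosure _ (mem_graph_gain_of_noise hG hC (c • S.noise) h)

theorem kalmanFilter_smul_noise (hC : S.C = 1) (l : ℝ) :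
    S.kalmanFilter ((l : ℂ) • S.noise) = decentralizedFilter S.A l := by
  rw [kalmanFilter, decentralizedFilter, kalmanGain_smul_noise hG hC, hC]
  rfl

end Noise

theorem solves_decentralizedFilter_iff {A : L2 →ₗ.[ℂ] L2} {l : ℝ} {y ψ : ℝ → L2} :
    (decentralizedFilter A l).Solves y ψ ↔
      ψ 0 = 0 ∧ ∀ t : ℝ, 0 ≤ t → ∃ h : ψ t ∈ A.domain,
        HasDerivWithinAt ψ ((A ⟨ψ t, h⟩ - (l : ℂ) • ψ t) + (l : ℂ) • y t) (Ici 0) t := by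
  refine and_congr_right fun _ => forall_congr' fun t => forall_congr' fun _ => ?_
  constructor
  · rintro ⟨h, h', hd⟩
    exact ⟨h.1, hd⟩
  · rintro ⟨h, hd⟩
    exact ⟨⟨h, trivial⟩, trivial, hd⟩

/-- The gain `ℓ` satisfies the matching condition. -/
def Matching (l : ℝ) (a b g : ℝ → ℂ) : Prop :=
  ∀ x : ℝ, ‖b x‖ ^ 2 = l * (l - 2 * (a x).re) * ‖g x‖ ^ 2

/-! ### Stability, uniqueness and minimality under the matching condition -/

namespace Assumptions

variable {a b c g : ℝ → ℂ} {l : ℝ}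

/-- The left side of the matching condition is positive since `b` has no zeros, which forces `ℓ - 2
Re a > 0`. -/
theorem re_symbol_lt (hS : S.Assumptions a b c g) (hl : 0 < l) (hm : Matching l a b g) (x : ℝ) :
    (a x).re < l / 2 := by
  by_contra! h
  have h1 : 0 < ‖b x‖ ^ 2 := by
    have := norm_pos_iff.2 (hS.rational_b.ne_zero x)
    positivity
  rw [hm x] at h1
  have h2 : l * (l - 2 * (a x).re) ≤ 0 := mul_nonpos_of_nonneg_of_nonpos hl.le (by linarith)
  exact absurd h1 (not_lt.2 (mul_nonpos_of_nonpos_of_nonneg h2 (by positivity)))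

theorem exists_errorSemigroup (hS : S.Assumptions a b c g) (hl : 0 < l)
    (hm : Matching l a b g) :
    ∃ T, IsC0Semigroup T ∧ IsGenerator (S.A - ofCLM ((l : ℂ) • 1)) T ∧
      IsExponentiallyStable T := by
  obtain ⟨T, hT, hG⟩ := hS.gen_A
  -- The bound `Re a < ℓ/2` gives `‖T(t)‖ ≤ exp(ℓt/2)`, and the shift by `-ℓ` leaves the decay rate
  -- `ℓ/2`.
  refine ⟨_, hT.exp_smul l, hG.exp_smul l, 1, l / 2, by positivity, fun t ht => ?_⟩
  have h1 := hT.norm_le_exp hG hS.dense_A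
    (hS.symbol_A.re_inner_le fun x => (hS.re_symbol_lt hl hm x).le) ht
  rw [norm_smul, Complex.norm_real, Real.norm_eq_abs, abs_of_pos (Real.exp_pos _), one_mul]
  calc _ ≤ Real.exp (-l * t) * Real.exp (l / 2 * t) := by gcongr
    _ = _ := by rw [← Real.exp_add]; congr 1; ring

theorem dense_adjoint (hS : S.Assumptions a b c g) (hl : 0 < l) (hm : Matching l a b g) :
    Dense {h | ∃ k, IsAdjointPair S.A h k} := by
  obtain ⟨T, hT, hG, hs⟩ := hS.exists_errorSemigroup hl hm
  obtain ⟨R, hR, hR'⟩ := hT.exists_inverse hG hs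
  refine (dense_isAdjointPair hR hR').mono ?_
  rintro h ⟨k, hk⟩
  exact ⟨_, isAdjointPair_of_sub_ofCLM hk⟩

theorem riccati_isAdjointPair (hS : S.Assumptions a b c g) (hl : 0 < l) (hm : Matching l a b g)
    {f f' h h' : L2} (hf : IsAdjointPair S.A f f') (hh : IsAdjointPair S.A h h') :
    (l : ℂ) * inner ℂ f' (S.noise h) + (l : ℂ) * inner ℂ f (S.noise h') +
      inner ℂ f (S.B (S.B.adjoint h)) - (l : ℂ) ^ 2 * inner ℂ f (S.noise h) = 0 := by
  obtain ⟨T, hT, hG, hs⟩ := hS.exists_errorSemigroup hl hm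
  obtain ⟨R, hR, -⟩ := hT.exists_inverse hG hs
  have hne : ∀ x, a x - l ≠ 0 := fun x h0 => by
    have h1 := congr(Complex.re $h0)
    simp only [Complex.sub_re, Complex.ofReal_re, Complex.zero_re] at h1
    linarith [hS.re_symbol_lt hl hm x]
  have ham := hS.continuous_a.measurable
  exact riccati_identity hS.symbol_B hS.symbol_G hS.rational_b.measurable
    hS.rational_g.measurable hm (hf.fourier_eq hS.symbol_A ham hne hR)
    (hh.fourier_eq hS.symbol_A ham hne hR)

theorem isPositive_smul_noise (hS : S.Assumptions a b c g) (hl : 0 < l) :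
    ((l : ℂ) • S.noise).IsPositive :=
  hS.posDef_G.1.smul_of_nonneg (by exact_mod_cast hl.le)

theorem solvesRiccati_smul_noise (hS : S.Assumptions a b c g) (hl : 0 < l)
    (hm : Matching l a b g) : S.SolvesRiccati ((l : ℂ) • S.noise) := by
  intro h
  have hCP : S.C (((l : ℂ) • S.noise) h) = S.noise ((l : ℂ) • (h : L2)) := by
    rw [hS.full_state, map_smul]
    rfl
  refine ⟨hCP ▸ noise_mem_domain hS.posDef_G _, fun f => ?_⟩
  have h1 : S.noiseInv ⟨S.C (((l : ℂ) • S.noise) h), hCP ▸ noise_mem_domain hS.posDef_G _⟩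
      = (l : ℂ) • (h : L2) := by
    simp only [hCP]
    exact noiseInv_noise hS.posDef_G _ _
  rw [h1, hS.full_state, adjoint_one, one_apply_eq_self]
  have h2 := hS.riccati_isAdjointPair hl hm (isAdjointPair_adjoint hS.dense_A f)
    (isAdjointPair_adjoint hS.dense_A h)
  simp only [_root_.smul_apply, inner_smul_right, map_smul]
  rw [← h2]
  ring

theorem isStabilizingSolution_smul_noise (hS : S.Assumptions a b c g) (hl : 0 < l)
    (hm : Matching l a b g) : S.IsStabilizingSolution ((l : ℂ) • S.noise) where
  selfAdjoint := (hS.isPositive_smul_noise hl).isSelfAdjoint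
  riccati := hS.solvesRiccati_smul_noise hl hm
  stabilizing := by
    rw [kalmanFilter_smul_noise hS.posDef_G hS.full_state]
    exact hS.exists_errorSemigroup hl hm

/-- The difference of the two Riccati solutions solves a Sylvester equation. Its strong form, not
just its weak form, is needed, so `X h` has to be placed in the domains of both `A` and the gain of
`Q`. -/
theorem eq_smul_noise (hS : S.Assumptions a b c g) (hl : 0 < l) (hm : Matching l a b g)
    {Q : L2 →L[ℂ] L2} (hQ : S.IsStabilizingSolution Q) : Q = (l : ℂ) • S.noise := by
  obtain ⟨T, hT, hG, hs⟩ := hS.exists_errorSemigroup hl hm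
  obtain ⟨R, hR, hR'⟩ := hT.exists_inverse hG hs
  obtain ⟨U, hU, hGU, hsU⟩ := hQ.stabilizing
  rw [← sub_eq_zero]
  refine eq_zero_of_intertwines hT hG hs (dense_domain_sub_ofCLM hS.dense_A _)
    (dense_isAdjointPair hR hR') hU hGU hsU fun h k' hk' => ?_
  have hk := isAdjointPair_of_sub_ofCLM hk'
  rw [adjoint_real_smul_one_apply] at hk
  set k := k' + (l : ℂ) • h with hkdef
  obtain ⟨hmem, hric⟩ := hQ.riccati ⟨h, hk.mem_domain⟩
  set q := S.noiseInv ⟨S.C (Q h), hmem⟩ with hq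
  have hNq : S.noise q = Q h := by
    have := (mem_graph_noiseInv hS.posDef_G).1 (S.noiseInv.mem_graph ⟨S.C (Q h), hmem⟩)
    rw [← hq] at this
    rw [this]
    simp [hS.full_state]
  set X := Q - (l : ℂ) • S.noise
  have hXapp : ∀ u, X u = Q u - (l : ℂ) • S.noise u := fun u => rfl
  have hXh : X h = S.noise (q - (l : ℂ) • h) := by
    rw [hXapp, map_sub, map_smul, hNq]
  -- The Riccati equations show that `X h` belongs to the domain of `A`.
  have hgraph : (X h, -X k + Q q - (l : ℂ) ^ 2 • S.noise h - (l : ℂ) • X h) ∈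
      (S.A - ofCLM ((l : ℂ) • 1)).graph := by
    refine mem_graph_of_inner_eq hR hR' fun f f'' hf'' => ?_
    have hf := isAdjointPair_of_sub_ofCLM hf''
    rw [adjoint_real_smul_one_apply] at hf
    have h1 := hric ⟨f, hf.mem_domain⟩
    rw [hf.adjoint_apply hS.dense_A, hk.adjoint_apply hS.dense_A, hS.full_state, adjoint_one,
      one_apply_eq_self] at h1
    have h2 := hS.riccati_isAdjointPair hl hm hf hk
    simp only [hXapp, inner_sub_right, inner_add_right, inner_neg_right, inner_smul_right,
      inner_add_left, inner_smul_left, Complex.conj_ofReal] at h1 h2 ⊢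
    linear_combination h1 - h2
  have hA := mem_graph_sub_ofCLM.1 hgraph
  rw [_root_.smul_apply, one_apply_eq_self, sub_add_cancel] at hA
  -- The Riccati equation puts `Q h` in the range of the noise covariance `N`. Hence so is `X h =
  -- N(q - ℓh)`, where the gain acts as `Q N⁻¹`.
  have hgain : (X h, Q (q - (l : ℂ) • h)) ∈ (S.kalmanGain Q).graph := by
    rw [hXh]
    exact mem_graph_kalmanGain hS.posDef_G hS.full_state Q _
  obtain ⟨x, hx1, hx2⟩ := (LinearPMap.mem_graph_iff _).1 hA
  obtain ⟨z, hz1, hz2⟩ := (LinearPMap.mem_graph_iff _).1 hgain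
  simp only at hx1 hx2 hz1 hz2
  have hxd : X h ∈ S.A.domain := hx1 ▸ x.2
  have hzd : S.C (X h) ∈ (S.kalmanGain Q).domain := by
    rw [hS.full_state, one_apply_eq_self, ← hz1]
    exact z.2
  refine (LinearPMap.mem_graph_iff _).2 ⟨⟨X h, hxd, hzd⟩, rfl, ?_⟩
  change S.A ⟨X h, hxd⟩ - S.kalmanGain Q ⟨S.C (X h), hzd⟩ = -X k'
  have e1 : (⟨X h, hxd⟩ : S.A.domain) = x := Subtype.ext hx1.symm
  have e2 : (⟨S.C (X h), hzd⟩ : (S.kalmanGain Q).domain) = z := by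
    refine Subtype.ext ?_
    simp [hS.full_state, hz1]
  -- The terms `Q q` cancel, and `ℓ Q h - ℓ² N h = ℓ X h` converts `-X k` into `-X k'`.
  rw [e1, e2, hx2, hz2, hkdef]
  simp only [map_add, map_sub, map_smul, hXapp]
  module

/-- Completion of the square: rewriting the Riccati identity for `A` with `A - K` adds a cross term
between `G*K*u` and `ℓ G*u`. This term and `ℓ²‖G*u‖²` combine into the square of the gain mismatch
`K* - ℓ`. -/
theorem re_energy_eq (hS : S.Assumptions a b c g) (hl : 0 < l) (hm : Matching l a b g)
    (K : L2 →L[ℂ] L2) {u k : L2} (hk : IsAdjointPair (S.A - ofCLM (K ∘L S.C)) u k) :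
    (inner ℂ (((l : ℂ) • S.noise) u) k + inner ℂ (((l : ℂ) • S.noise) k) u : ℂ).re =
      -(‖S.B.adjoint u‖ ^ 2 + ‖S.G.adjoint (K.adjoint u)‖ ^ 2 -
        ‖S.G.adjoint (K.adjoint u - (l : ℂ) • u)‖ ^ 2) := by
  have hk' := isAdjointPair_of_sub_ofCLM hk
  have hK : (K ∘L S.C).adjoint u = K.adjoint u := by
    rw [hS.full_state, ContinuousLinearMap.adjoint_comp, adjoint_one]
    rfl
  rw [hK] at hk'
  have h1 := congr(Complex.re $(hS.riccati_isAdjointPair hl hm hk' hk'))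
  have hself : ∀ v : L2, (inner ℂ v v : ℂ).re = ‖v‖ ^ 2 := fun v =>
    inner_self_eq_norm_sq (𝕜 := ℂ) v
  have hre : ∀ v w : L2, (inner ℂ v w : ℂ).re = (inner ℂ w v : ℂ).re := fun v w => by
    rw [← inner_conj_symm, Complex.conj_re]
  rw [← Complex.ofReal_pow, Complex.sub_re, Complex.add_re, Complex.add_re,
    Complex.re_ofReal_mul, Complex.re_ofReal_mul, Complex.re_ofReal_mul, Complex.zero_re,
    inner_noise, inner_noise, inner_noise, ← ContinuousLinearMap.adjoint_inner_left S.B, hself,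
    hself,
    map_add, inner_add_left, inner_add_right, Complex.add_re, Complex.add_re,
    hre (S.G.adjoint u) (S.G.adjoint (K.adjoint u)), hre (S.G.adjoint u) (S.G.adjoint k)] at h1
  have hsq : ‖S.G.adjoint (K.adjoint u - (l : ℂ) • u)‖ ^ 2 =
      ‖S.G.adjoint (K.adjoint u)‖ ^ 2 -
        2 * (l * (inner ℂ (S.G.adjoint (K.adjoint u)) (S.G.adjoint u) : ℂ).re) +
        l ^ 2 * ‖S.G.adjoint u‖ ^ 2 := by
    have h2 := norm_sub_sq (𝕜 := ℂ) (S.G.adjoint (K.adjoint u)) ((l : ℂ) • S.G.adjoint u)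
    rw [inner_smul_right, norm_smul, Complex.norm_real, Real.norm_eq_abs, abs_of_pos hl,
      RCLike.re_to_complex, Complex.re_ofReal_mul, mul_pow] at h2
    rw [map_sub, map_smul, h2]
  have e1 : (inner ℂ (((l : ℂ) • S.noise) u) k : ℂ).re =
      l * (inner ℂ (S.G.adjoint k) (S.G.adjoint u) : ℂ).re := by
    rw [_root_.smul_apply, inner_smul_left, Complex.conj_ofReal, Complex.re_ofReal_mul,
      inner_noise_left, inner_noise, hre]
  have e2 : (inner ℂ (((l : ℂ) • S.noise) k) u : ℂ).re =
      l * (inner ℂ (S.G.adjoint k) (S.G.adjoint u) : ℂ).re := by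
    rw [_root_.smul_apply, inner_smul_left, Complex.conj_ofReal, Complex.re_ofReal_mul,
      inner_noise_left, inner_noise]
  rw [hsq, Complex.add_re, e1, e2]
  linarith

theorem errorVariance_smul_one (hS : S.Assumptions a b c g) (hl : 0 < l)
    (hm : Matching l a b g) {T : ℝ → L2 →L[ℂ] L2}
    (hT : S.IsErrorSemigroup ((l : ℂ) • 1) T) (h : L2) :
    S.errorVariance ((l : ℂ) • 1) T h =
      ENNReal.ofReal (inner ℂ (((l : ℂ) • S.noise) h) h : ℂ).re := by
  refine hT.1.lintegral_eq_ofReal_energy hT.2.1 (dense_domain_sub_ofCLM hS.dense_A _)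
    (dense_isAdjointPair_sub_ofCLM (hS.dense_adjoint hl hm) _) hT.2.2
    (φ := fun u => ‖S.B.adjoint u‖ ^ 2 +
      ‖S.G.adjoint (((l : ℂ) • (1 : L2 →L[ℂ] L2)).adjoint u)‖ ^ 2)
    (by fun_prop) (fun u k hk => ?_) (fun u => by positivity) h
  rw [hS.re_energy_eq hl hm _ hk, adjoint_real_smul_one_apply, sub_self, map_zero, norm_zero]
  ring

theorem le_errorVariance (hS : S.Assumptions a b c g) (hl : 0 < l) (hm : Matching l a b g)
    {K : L2 →L[ℂ] L2} {T : ℝ → L2 →L[ℂ] L2} (hT : S.IsErrorSemigroup K T) (h : L2) :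
    ENNReal.ofReal (inner ℂ (((l : ℂ) • S.noise) h) h : ℂ).re ≤ S.errorVariance K T h := by
  refine hT.1.ofReal_energy_le hT.2.1 (dense_domain_sub_ofCLM hS.dense_A _)
    (dense_isAdjointPair_sub_ofCLM (hS.dense_adjoint hl hm) _) hT.2.2
    (φ := fun u => ‖S.B.adjoint u‖ ^ 2 + ‖S.G.adjoint (K.adjoint u)‖ ^ 2 -
        ‖S.G.adjoint (K.adjoint u - (l : ℂ) • u)‖ ^ 2)
    (ψ := fun u => ‖S.B.adjoint u‖ ^ 2 + ‖S.G.adjoint (K.adjoint u)‖ ^ 2)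
    (by fun_prop) (fun u k hk => hS.re_energy_eq hl hm K hk) (by fun_prop)
    (fun u => by positivity) (fun u => sub_le_self _ (by positivity)) h

end Assumptions

end Plant

theorem hasFourierSymbol_ofCLM_smul_one (z : ℂ) :
    HasFourierSymbol (ofCLM (z • 1)) fun _ => z := by
  rintro ⟨f, -⟩
  change (𝓕 (z • f) : L2) =ᵐ[volume] _
  rw [FourierTransform.fourier_smul]
  exact Lp.coeFn_smul z (𝓕 f : L2)

end SIS

theorem proposition1 (S : SIS.Plant) (a b c g : ℝ → ℂ) (hS : S.Assumptions a b c g)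
    (l : ℝ) (hl : 0 < l)
    (hmatch : ∀ x : ℝ, ‖b x‖ ^ 2 = l * (l - 2 * (a x).re) * ‖g x‖ ^ 2) :
    ∃ P : SIS.L2 →L[ℂ] SIS.L2,
      -- the Kalman filter is well defined: the Riccati equation has exactly one stabilizing
      -- solution, and it is a nonnegative operator
      S.IsStabilizingSolution P ∧ (∀ Q, S.IsStabilizingSolution Q → Q = P) ∧ P.IsPositive ∧
      -- the Kalman gain is `ℓ I` and its Fourier symbol is identically `ℓ`
      S.kalmanGain P = SIS.ofCLM ((l : ℂ) • 1) ∧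
      SIS.HasFourierSymbol (S.kalmanGain P) (fun _ => (l : ℂ)) ∧
      -- the Kalman filter is `dψ~/dt = (A - ℓ I) ψ~ + ℓ y`, hence completely decentralized
      S.kalmanFilter P = SIS.decentralizedFilter S.A l ∧
      (S.kalmanFilter P).IsCompletelyDecentralized S.A ∧
      (∀ y ψ : ℝ → SIS.L2, (S.kalmanFilter P).Solves y ψ ↔
        ψ 0 = 0 ∧ ∀ t : ℝ, 0 ≤ t → ∃ h : ψ t ∈ S.A.domain,
          HasDerivWithinAt ψ ((S.A ⟨ψ t, h⟩ - (l : ℂ) • ψ t) + (l : ℂ) • y t) (Ici 0) t) ∧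
      -- `P` is the steady state error covariance of this filter, and no filter with a bounded
      -- stabilizing gain has a smaller one
      (∀ T, S.IsErrorSemigroup ((l : ℂ) • 1) T → ∀ h : SIS.L2,
        S.errorVariance ((l : ℂ) • 1) T h = ENNReal.ofReal ((inner ℂ (P h) h : ℂ).re)) ∧
      (∀ K T, S.IsErrorSemigroup K T → ∀ h : SIS.L2,
        ENNReal.ofReal ((inner ℂ (P h) h : ℂ).re) ≤ S.errorVariance K T h) := by
  have hG := hS.posDef_G
  have hC := hS.full_state
  have hF := SIS.Plant.kalmanFilter_smul_noise hG hC l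
  have hK := SIS.Plant.kalmanGain_smul_noise hG hC (l : ℂ)
  refine ⟨(l : ℂ) • S.noise, hS.isStabilizingSolution_smul_noise hl hmatch,
    fun Q hQ => hS.eq_smul_noise hl hmatch hQ, hS.isPositive_smul_noise hl, hK, ?_, hF,
    ⟨l, hl, hF⟩, fun y ψ => ?_, fun T hT h => hS.errorVariance_smul_one hl hmatch hT h,
    fun K T hT h => hS.le_errorVariance hl hmatch hT h⟩
  · rw [hK]
    exact SIS.hasFourierSymbol_ofCLM_smul_one _
  · rw [hF]
    exact SIS.Plant.solves_decentralizedFilter_iff
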